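/- Setting. Let $n,d\ge 1$. A normalized ordered norm on $\mathbb{R}^d$ is $\|x\|_\beta=\sum_{i=1}^d\beta_i\,(|x|^{\downarrow})_i$, where $\beta_1\ge\dots\ge\beta_d\ge 0$, $\sum_i\beta_i=1$, and $(|x|^{\downarrow})_i$ is the $i$-th largest of $|x_1|,\dots,|x_d|$. A differentiable convex function $\Psi:\mathbb{R}^d_{\ge0}\to\mathbb{R}_{\ge 0}$ is a $(\delta,\eta)$-approximation of $\|\cdot\|_\beta$ if for all $x,y\in\mathbb{R}^d_{\ge 0}$ we have $\|x\|_\beta\le\Psi(x)\le\|x\|_\beta+\delta$ and $\nabla\Psi(x+y)\le\exp(\eta\|y\|_\infty)\,\nabla\Psi(x)$ componentwise. An instance consists of $n$ closed convex sets $X_c\subseteq\mathbb{R}^d_{\ge0}$ (one for each customer $c$); let $X=\sum_c X_c$ and $\mathrm{OPT}=\min_{x\in X}\|x\|_\beta$. The sets are given by $\tau$-approximate linear minimization oracles, i.e. functions $f_c:\mathbb{R}^d_{\ge0}\to X_c$ with $\langle f_c(y),y\rangle\le\tau\,\langle x,y\rangle$ for all $y\in\mathbb{R}^d_{\ge0}$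 and $x\in X_c$. Algorithms are randomized; they know $d,\beta,n,\varepsilon,\tau$, and access the sets $X_c$ only by oracle calls (evaluating some $f_c$ at some $y\in\mathbb{R}^d_{\ge0}$), and $\Psi$ only by evaluating $\nabla\Psi$ at points of $\mathbb{R}^d_{\ge0}$; both kinds of accesses are counted. Theorem. For every constant $\tau\ge1$ there are a constant $K>0$, depending only on $\tau$, and a randomized algorithm such that the following holds for every normalized ordered norm $\|\cdot\|_\beta$ on $\mathbb{R}^d$, every $(\ln d,1)$-approximation $\Psi$ of it, every instance with $\tau$-approximate oracles $(f_c)_c$, and every $\varepsilon\in(0,1]$. Put $$\Omega^*=K\,(n+d)\,\log(n+d)\,\bigl(\varepsilon^{-2}+\log\log d\bigr),$$ where $\log\log d$ is read as $0$ if $d=1$. The algorithm always stops with a solution $x\in X$ satisfying $\|x\|_\beta\le(1+\varepsilon)\,\tau\cdot\mathrm{OPT}$, after at most $\Omega^*$ gradient evaluations of $\Psi$ and at most $n\,\Omega^*$ oracle calls in total; and it makes more than $\Omega^*$ oracle calls with probability at most $(nd)^{-18}$. -/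

import Mathlib

open scoped NNReal ENNReal

noncomputable section

namespace OrderedNormMin

/-- Weight vectors of normalized ordered norms on `ℝ^d`: non-negative, non-increasing, with
entries summing to one (in particular `d ≥ 1`). -/
structure IsOrderedWeight {d : ℕ} (β : Fin d → ℝ) : Prop where
  nonneg : ∀ i, 0 ≤ β i
  antitone : Antitone β
  sum_eq_one : ∑ i, β i = 1

/-- The vector `x↓`: the entries of `x` in non-increasing order. -/
def sortDown {d : ℕ} (x : Fin d → ℝ) : Fin d → ℝ :=
  fun i => x (Tuple.sort (fun j => -x j) i)

/-- The ordered norm with weights `β`: the sum of `β i` times the `i`-th largest entry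
of `(|x 1|, …, |x d|)`. -/
def orderedNorm {d : ℕ} (β : Fin d → ℝ) (x : Fin d → ℝ) : ℝ :=
  ∑ i, β i * sortDown (fun j => |x j|) i

/-- The non-negative orthant of `ℝ^d`. -/
def orthant (d : ℕ) : Set (Fin d → ℝ) := Set.Ici 0

/-- The gradient of a function on the non-negative orthant, as the vector of partial derivatives.
(The derivative is taken within the orthant, where it is unique.) -/
def orthantGrad {d : ℕ} (Ψ : (Fin d → ℝ) → ℝ) (x : Fin d → ℝ) : Fin d → ℝ :=
  fun i => fderivWithin ℝ Ψ (orthant d) x (Pi.single i 1)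

/-- `(δ, η)`-approximations of the ordered norm with weights `β`. Only the values of `Ψ` on the
non-negative orthant matter. The norm of `Fin d → ℝ` is the sup norm. -/
structure IsNormApprox {d : ℕ} (β : Fin d → ℝ) (Ψ : (Fin d → ℝ) → ℝ) (δ η : ℝ) : Prop where
  differentiable : DifferentiableOn ℝ Ψ (orthant d)
  convex : ConvexOn ℝ (orthant d) Ψ
  norm_le : ∀ x ∈ orthant d, orderedNorm β x ≤ Ψ x
  le_norm_add : ∀ x ∈ orthant d, Ψ x ≤ orderedNorm β x + δ
  grad_le : ∀ x ∈ orthant d, ∀ y ∈ orthant d, ∀ i,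
    orthantGrad Ψ (x + y) i ≤ Real.exp (η * ‖y‖) * orthantGrad Ψ x i

/-- The standing assumptions on the sets `X c` of the customers. -/
structure IsInstance {n d : ℕ} (X : Fin n → Set (Fin d → ℝ)) : Prop where
  closed : ∀ c, IsClosed (X c)
  convex : ∀ c, Convex ℝ (X c)
  subset_orthant : ∀ c, X c ⊆ orthant d

/-- The set of feasible solutions, the Minkowski sum of the sets `X c`. -/
def feasible {n d : ℕ} (X : Fin n → Set (Fin d → ℝ)) : Set (Fin d → ℝ) :=
  {x | ∃ z : Fin n → Fin d → ℝ, (∀ c, z c ∈ X c) ∧ x = ∑ c, z c}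

/-- The optimum value of minimizing the ordered norm over the feasible solutions. -/
def optValue {n d : ℕ} (β : Fin d → ℝ) (X : Fin n → Set (Fin d → ℝ)) : ℝ :=
  sInf (orderedNorm β '' feasible X)

/-- `f` is a family of `τ`-approximate linear minimization oracles: for every non-negative price
vector `y`, the vector `f c y` lies in `X c` and costs at most `τ` times as much as any element
of `X c`. -/
def IsApproxOracle {n d : ℕ} (τ : ℝ) (X : Fin n → Set (Fin d → ℝ))
    (f : Fin n → (Fin d → ℝ≥0) → (Fin d → ℝ)) : Prop :=
  ∀ (c : Fin n) (y : Fin d → ℝ≥0), f c y ∈ X c ∧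
    ∀ x ∈ X c, ∑ i, f c y i * (y i : ℝ) ≤ τ * ∑ i, x i * (y i : ℝ)

/-- Randomized algorithms for `n` customers and `d` resources whose only access to the sets of the
customers is by calls to their linear minimization oracles, and whose only access to the norm
approximation is by gradient evaluations. The algorithm either stops with an output, or calls the
oracle of a customer `c` with non-negative prices `y`, or evaluates the gradient at a non-negative
point `x`, or makes a random choice with a finite distribution of its choice; in the last three
cases it continues depending on the answer. Every execution is finite. -/
inductive Algorithm (n d : ℕ) : Type where
  | output (x : Fin d → ℝ) : Algorithm n d
  | callOracle (c : Fin n) (y : Fin d → ℝ≥0) (next : (Fin d → ℝ) → Algorithm n d) : Algorithm n d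
  | evalGrad (x : Fin d → ℝ≥0) (next : (Fin d → ℝ) → Algorithm n d) : Algorithm n d
  | choose (m : ℕ) (p : PMF (Fin m)) (next : Fin m → Algorithm n d) : Algorithm n d

/-- The outcome of an execution: the output, the number of oracle calls (over all customers), and
the number of gradient evaluations. -/
structure Outcome (d : ℕ) where
  solution : Fin d → ℝ
  oracleCalls : ℕ
  gradEvals : ℕ

/-- The distribution of the outcome of an algorithm, when the oracles of the customers are `f` and
gradient evaluations are answered by `g`. -/
def Algorithm.run {n d : ℕ} (f : Fin n → (Fin d → ℝ≥0) → (Fin d → ℝ))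
    (g : (Fin d → ℝ) → (Fin d → ℝ)) : Algorithm n d → PMF (Outcome d)
  | .output x => PMF.pure ⟨x, 0, 0⟩
  | .callOracle c y next =>
      (Algorithm.run f g (next (f c y))).map
        fun r => ⟨r.solution, r.oracleCalls + 1, r.gradEvals⟩
  | .evalGrad x next =>
      (Algorithm.run f g (next (g fun i => (x i : ℝ)))).map
        fun r => ⟨r.solution, r.oracleCalls, r.gradEvals + 1⟩
  | .choose _ p next => p.bind fun i => Algorithm.run f g (next i)

/-- `(n + d) log (n + d) (ε⁻² + log log d)`. For `d = 1` the last summand is zero here,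
because `Real.log 0 = 0`. -/
def rate (n d : ℕ) (ε : ℝ) : ℝ :=
  ((n : ℝ) + d) * Real.log ((n : ℝ) + d) * ((ε ^ 2)⁻¹ + Real.log (Real.log d))

end OrderedNormMin

end

/-! The algorithm is a multiplicative weights scheme for resource sharing. Gradients of Ψ at the
current load serve as prices. They lie in the dual unit ball of the norm
(`IsNormApprox.grad_inner_le`), so the cost of all oracle answers at these prices is at most τ·OPT
(`oracle_cost_le`). If that cost exceeds τ times the current guess μ of OPT, then μ < OPT and the
guess is raised by the factor 1 + ε/3. Otherwise one customer is sampled and takes a step of size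
about gain/probability towards its answer. In expectation this raises Ψ(load) by at most τ·gain, and
raises the soft minimum -log Σ exp(-progress) by about gain. Once both have grown far beyond
log(n+d), their quotient is at most (1+ε/3)τ (`potential_ratio`). Averaging the answers of each
customer then yields a solution of norm at most (1+ε/3)²·τ·OPT.

Two devices keep the steps under control without any bound on the size of the answers. The step size
ξ solves ξ = (gain/prob)(1-‖v‖), where v is the change of the load, and exp ‖v‖·(1-‖v‖) ≤ 1 cancels
the growth of the prices; the progress lost in this way is charged to the total load. Answers of
relative cost above 4τ are rejected, so that the random deviations are bounded; a rejection saves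
more in the bound on Ψ than it loses in progress. All this is recorded pathwise by `State.Inv`, in
terms of the accumulated deviations `costErr` and `gainErr`.

The deviations are governed by an exponential potential. An iteration queries all customers with
probability 1/(n+1), which makes n + O(N/(n+1)·n) calls in N iterations typical. A guess that is too
small can go unnoticed while single customers are sampled; the amount subtracted from `costErr` at a
raise pays for this, so the expected potential grows slowly in every case
(`State.mean_potential_le`). Hence the deviations are small except with tiny probability
(`prob_randLoop_le`). In the exceptional case the algorithm starts again with all customers queried
in every iteration, and it picks the customer that minimizes the potential. By the method of
conditional expectations this run cannot fail. -/

noncomputable section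

namespace OrderedNormMin

/-! ### Ordered norms via rearrangement. -/

section OrderedNorm

variable {d : ℕ} {β : Fin d → ℝ}

theorem antitone_sortDown (x : Fin d → ℝ) : Antitone (sortDown x) := by
  intro i j hij
  have h := Tuple.monotone_sort (fun j => -x j) hij
  simp only [Function.comp_apply, neg_le_neg_iff] at h
  exact h

/-- The rearrangement inequality. Since sorting attains equality, the norm is a maximum over
permutations, and its norm properties follow without handling the sort. -/
theorem sum_perm_le_orderedNorm (hβ : IsOrderedWeight β) (x : Fin d → ℝ)
    (π : Equiv.Perm (Fin d)) : ∑ i, β i * |x (π i)| ≤ orderedNorm β x := by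
  set σ := Tuple.sort (fun j => -|x j|) with hσ
  have hm : Monovary β (sortDown fun j => |x j|) :=
    hβ.antitone.monovary (antitone_sortDown _)
  have h := hm.sum_mul_comp_perm_le_sum_mul (σ := π.trans σ.symm)
  refine le_trans (le_of_eq ?_) h
  refine Finset.sum_congr rfl fun i _ => ?_
  simp [sortDown, ← hσ]

theorem exists_perm_orderedNorm_eq (β : Fin d → ℝ) (x : Fin d → ℝ) :
    ∃ π : Equiv.Perm (Fin d), orderedNorm β x = ∑ i, β i * |x (π i)| :=
  ⟨Tuple.sort (fun j => -|x j|), rfl⟩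

theorem orderedNorm_nonneg (hβ : IsOrderedWeight β) (x : Fin d → ℝ) : 0 ≤ orderedNorm β x :=
  Finset.sum_nonneg fun i _ => mul_nonneg (hβ.nonneg i) (abs_nonneg _)

theorem orderedNorm_le_of_abs_le (hβ : IsOrderedWeight β) {x y : Fin d → ℝ}
    (h : ∀ i, |x i| ≤ |y i|) : orderedNorm β x ≤ orderedNorm β y := by
  obtain ⟨π, hπ⟩ := exists_perm_orderedNorm_eq β x
  rw [hπ]
  exact (Finset.sum_le_sum fun i _ => mul_le_mul_of_nonneg_left (h (π i)) (hβ.nonneg i)).trans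
    (sum_perm_le_orderedNorm hβ y π)

theorem orderedNorm_smul_le (hβ : IsOrderedWeight β) {a : ℝ} (ha : 0 ≤ a) (x : Fin d → ℝ) :
    orderedNorm β (a • x) ≤ a * orderedNorm β x := by
  obtain ⟨π, hπ⟩ := exists_perm_orderedNorm_eq β (a • x)
  have h := mul_le_mul_of_nonneg_left (sum_perm_le_orderedNorm hβ x π) ha
  rw [hπ]
  refine le_trans (le_of_eq ?_) h
  rw [Finset.mul_sum]
  refine Finset.sum_congr rfl fun i _ => ?_
  simp only [Pi.smul_apply, smul_eq_mul, abs_mul, abs_of_nonneg ha]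
  ring

theorem orderedNorm_add_le (hβ : IsOrderedWeight β) (x y : Fin d → ℝ) :
    orderedNorm β (x + y) ≤ orderedNorm β x + orderedNorm β y := by
  obtain ⟨π, hπ⟩ := exists_perm_orderedNorm_eq β (x + y)
  rw [hπ]
  refine le_trans ?_ (add_le_add (sum_perm_le_orderedNorm hβ x π) (sum_perm_le_orderedNorm hβ y π))
  rw [← Finset.sum_add_distrib]
  refine Finset.sum_le_sum fun i _ => ?_
  rw [← mul_add]
  exact mul_le_mul_of_nonneg_left (abs_add_le _ _) (hβ.nonneg i)

/-- Chebyshev's sum inequality for two non-increasing sequences. It bounds the total load by d·Ψ,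
and it shows that the all-ones prices have dual norm at most d. -/
theorem sum_le_card_mul_orderedNorm (hβ : IsOrderedWeight β) (x : Fin d → ℝ) :
    ∑ i, x i ≤ d * orderedNorm β x := by
  have hm : Monovary β (sortDown fun j => |x j|) :=
    hβ.antitone.monovary (antitone_sortDown _)
  have h := hm.sum_mul_sum_le_card_mul_sum
  rw [hβ.sum_eq_one, one_mul, Fintype.card_fin] at h
  refine le_trans ?_ h
  have : ∑ i, sortDown (fun j => |x j|) i = ∑ i, |x i| :=
    Equiv.sum_comp (Tuple.sort (fun j => -|x j|)) (fun i => |x i|)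
  rw [this]
  exact Finset.sum_le_sum fun i _ => le_abs_self _

theorem IsOrderedWeight.le_one (hβ : IsOrderedWeight β) (i : Fin d) : β i ≤ 1 := by
  rw [← hβ.sum_eq_one]
  exact Finset.single_le_sum (fun j _ => hβ.nonneg j) (Finset.mem_univ i)

theorem IsOrderedWeight.dim_pos (hβ : IsOrderedWeight β) : 1 ≤ d := by
  rcases Nat.eq_zero_or_pos d with h | h
  · subst h
    simpa using hβ.sum_eq_one
  · exact h

theorem orderedNorm_le_sum (hβ : IsOrderedWeight β) {x : Fin d → ℝ} (hx : x ∈ orthant d) :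
    orderedNorm β x ≤ ∑ i, x i := by
  obtain ⟨π, hπ⟩ := exists_perm_orderedNorm_eq β x
  rw [hπ, ← Equiv.sum_comp π x]
  refine Finset.sum_le_sum fun i _ => ?_
  rw [abs_of_nonneg (hx (π i))]
  exact mul_le_of_le_one_left (hx (π i)) (hβ.le_one i)

theorem orderedNorm_mono (hβ : IsOrderedWeight β) {x y : Fin d → ℝ} (hx : x ∈ orthant d)
    (h : ∀ i, x i ≤ y i) : orderedNorm β x ≤ orderedNorm β y :=
  orderedNorm_le_of_abs_le hβ fun i => by
    rw [abs_of_nonneg (hx i)]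
    exact (h i).trans (le_abs_self _)

end OrderedNorm

/-! ### Gradients of norm approximations as prices. -/

section Gradient

variable {d : ℕ} {β : Fin d → ℝ} {Ψ : (Fin d → ℝ) → ℝ} {δ η : ℝ}

theorem add_mem_orthant {x y : Fin d → ℝ} (hx : x ∈ orthant d) (hy : y ∈ orthant d) :
    x + y ∈ orthant d := fun i => add_nonneg (hx i) (hy i)

theorem smul_mem_orthant {a : ℝ} (ha : 0 ≤ a) {x : Fin d → ℝ} (hx : x ∈ orthant d) :
    a • x ∈ orthant d := fun i => mul_nonneg ha (hx i)

theorem fderivWithin_orthant_apply (Ψ : (Fin d → ℝ) → ℝ) (x v : Fin d → ℝ) :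
    fderivWithin ℝ Ψ (orthant d) x v = ∑ i, orthantGrad Ψ x i * v i := by
  conv_lhs => rw [← Finset.univ_sum_single v]
  rw [map_sum]
  refine Finset.sum_congr rfl fun i _ => ?_
  have : (Pi.single i (v i) : Fin d → ℝ) = v i • Pi.single i (1 : ℝ) := by
    rw [← Pi.single_smul, smul_eq_mul, mul_one]
  rw [this, map_smul, smul_eq_mul, mul_comm]
  rfl

/-- The first order condition for convex functions on the orthant. -/
theorem IsNormApprox.add_grad_le (h : IsNormApprox β Ψ δ η) {x z : Fin d → ℝ}
    (hx : x ∈ orthant d) (hz : z ∈ orthant d) :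
    Ψ x + ∑ i, orthantGrad Ψ x i * (z i - x i) ≤ Ψ z := by
  set γ : ℝ → Fin d → ℝ := ⇑(AffineMap.lineMap (k := ℝ) x z) with hγ
  have hmaps : Set.MapsTo γ (Set.Icc 0 1) (orthant d) := fun t ht =>
    h.convex.1.lineMap_mem hx hz ht
  have hconv : ConvexOn ℝ (Set.Icc (0 : ℝ) 1) (Ψ ∘ γ) :=
    (h.convex.comp_affineMap (AffineMap.lineMap (k := ℝ) x z)).subset hmaps (convex_Icc 0 1)
  have hγ0 : γ 0 = x := AffineMap.lineMap_apply_zero x z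
  have hγ1 : γ 1 = z := AffineMap.lineMap_apply_one x z
  have hd : HasDerivWithinAt γ (z - x) (Set.Icc 0 1) 0 :=
    AffineMap.hasDerivWithinAt_lineMap
  have hF : HasFDerivWithinAt Ψ (fderivWithin ℝ Ψ (orthant d) x) (orthant d) (γ 0) := by
    rw [hγ0]
    exact (h.differentiable x hx).hasFDerivWithinAt
  have hcomp := hF.comp_hasDerivWithinAt 0 hd hmaps
  have hs := hconv.le_slope_of_hasDerivWithinAt (x := 0) (y := 1) (by simp) (by simp) one_pos hcomp
  rw [slope_def_field, fderivWithin_orthant_apply] at hs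
  simp only [Function.comp_apply, hγ0, hγ1, sub_zero, div_one, Pi.sub_apply] at hs
  linarith

theorem IsNormApprox.nonneg (hβ : IsOrderedWeight β) (h : IsNormApprox β Ψ δ η) {x : Fin d → ℝ}
    (hx : x ∈ orthant d) : 0 ≤ Ψ x := (orderedNorm_nonneg hβ x).trans (h.norm_le x hx)

/-- A negative partial derivative could only decrease further along its coordinate direction,
because the gradient grows by a factor of at least one in `grad_le`. Moving far enough would make Ψ
negative. -/
theorem IsNormApprox.grad_nonneg (hβ : IsOrderedWeight β) (hη : 0 ≤ η) (h : IsNormApprox β Ψ δ η)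
    {x : Fin d → ℝ} (hx : x ∈ orthant d) (i : Fin d) : 0 ≤ orthantGrad Ψ x i := by
  by_contra! hneg
  set t : ℝ := (Ψ x + 1) / (-orthantGrad Ψ x i) with ht
  have hΨ := h.nonneg hβ hx
  have ht0 : 0 ≤ t := div_nonneg (by linarith) (by linarith)
  have hv : (Pi.single i t : Fin d → ℝ) ∈ orthant d := by
    intro j
    by_cases hj : j = i
    · subst hj; simpa using ht0
    · simp [hj]
  have hxv := add_mem_orthant hx hv
  have h1 := h.add_grad_le hxv hx
  have h2 : ∑ j, orthantGrad Ψ (x + Pi.single i t) j * (x j - (x + Pi.single i t : Fin d → ℝ) j)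
      = -(t * orthantGrad Ψ (x + Pi.single i t) i) := by
    rw [Finset.sum_eq_single i]
    · simp; ring
    · intro j _ hj; simp [hj]
    · simp
  rw [h2] at h1
  have h3 := h.grad_le x hx _ hv i
  have h4 : Real.exp (η * ‖(Pi.single i t : Fin d → ℝ)‖) * orthantGrad Ψ x i ≤
      orthantGrad Ψ x i := by
    have : 1 ≤ Real.exp (η * ‖(Pi.single i t : Fin d → ℝ)‖) :=
      Real.one_le_exp (mul_nonneg hη (norm_nonneg _))
    nlinarith
  have h5 := mul_le_mul_of_nonneg_left (h3.trans h4) ht0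
  have h6 : t * orthantGrad Ψ x i = -(Ψ x + 1) := by
    rw [ht, div_mul_eq_mul_div, div_eq_iff (by linarith)]; ring
  have h7 := h.nonneg hβ hxv
  linarith

/-- On the ray x + t·z the function Ψ exceeds the norm by at most δ. By convexity its initial slope
is at most its asymptotic slope, which is at most the norm of z. -/
theorem IsNormApprox.grad_inner_le (hβ : IsOrderedWeight β) (h : IsNormApprox β Ψ δ η)
    {x z : Fin d → ℝ} (hx : x ∈ orthant d) (hz : z ∈ orthant d) :
    ∑ i, z i * orthantGrad Ψ x i ≤ orderedNorm β z := by
  by_contra! hlt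
  set a := ∑ i, z i * orthantGrad Ψ x i - orderedNorm β z with ha
  have ha0 : 0 < a := by linarith
  have key : ∀ t : ℝ, 0 ≤ t → t * a ≤ orderedNorm β x + δ - Ψ x := by
    intro t ht
    have hxt := add_mem_orthant hx (smul_mem_orthant ht hz)
    have h1 := h.add_grad_le hx hxt
    have h2 := h.le_norm_add _ hxt
    have h3 := orderedNorm_add_le hβ x (t • z)
    have h4 := orderedNorm_smul_le hβ ht z
    have h5 : ∑ i, orthantGrad Ψ x i * ((x + t • z) i - x i) =
        t * ∑ i, z i * orthantGrad Ψ x i := by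
      rw [Finset.mul_sum]
      refine Finset.sum_congr rfl fun i _ => ?_
      simp; ring
    rw [h5] at h1
    rw [ha, mul_sub]
    linarith
  have h0 := key 0 le_rfl
  have h1 := key ((orderedNorm β x + δ - Ψ x + 1) / a) (div_nonneg (by linarith) ha0.le)
  rw [div_mul_cancel₀ _ ha0.ne'] at h1
  linarith

/-- Moving by `v` increases `Ψ` by at most the price of `v`, up to the change of the prices. -/
theorem IsNormApprox.le_add_exp_mul (h : IsNormApprox β Ψ δ 1) {x v : Fin d → ℝ}
    (hx : x ∈ orthant d) (hv : v ∈ orthant d) :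
    Ψ (x + v) ≤ Ψ x + Real.exp ‖v‖ * ∑ i, v i * orthantGrad Ψ x i := by
  have hxv := add_mem_orthant hx hv
  have h1 := h.add_grad_le hxv hx
  have h2 : ∑ i, orthantGrad Ψ (x + v) i * (x i - (x + v) i) =
      -∑ i, v i * orthantGrad Ψ (x + v) i := by
    rw [← Finset.sum_neg_distrib]
    refine Finset.sum_congr rfl fun i _ => ?_
    simp; ring
  have h3 : ∑ i, v i * orthantGrad Ψ (x + v) i ≤
      Real.exp ‖v‖ * ∑ i, v i * orthantGrad Ψ x i := by
    rw [Finset.mul_sum]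
    refine Finset.sum_le_sum fun i _ => ?_
    have := mul_le_mul_of_nonneg_left (h.grad_le x hx v hv i) (hv i)
    rw [one_mul] at this
    linarith
  linarith

end Gradient

/-! ### The optimum value and weak duality. -/

section OptValue

variable {n d : ℕ} {β : Fin d → ℝ} {X : Fin n → Set (Fin d → ℝ)} {τ : ℝ}
  {f : Fin n → (Fin d → ℝ≥0) → (Fin d → ℝ)}

theorem feasible_subset_orthant (hX : IsInstance X) : feasible X ⊆ orthant d := by
  rintro x ⟨z, hz, rfl⟩ i
  rw [Finset.sum_apply]
  exact Finset.sum_nonneg fun c _ => hX.subset_orthant c (hz c) i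

theorem sum_oracle_mem_feasible (hf : IsApproxOracle τ X f) (y : Fin d → ℝ≥0) :
    ∑ c, f c y ∈ feasible X := ⟨fun c => f c y, fun c => (hf c y).1, rfl⟩

theorem optValue_le (hβ : IsOrderedWeight β) {x : Fin d → ℝ} (hx : x ∈ feasible X) :
    optValue β X ≤ orderedNorm β x :=
  csInf_le ⟨0, by rintro _ ⟨x, _, rfl⟩; exact orderedNorm_nonneg hβ x⟩ ⟨x, hx, rfl⟩

theorem optValue_nonneg (hβ : IsOrderedWeight β) : 0 ≤ optValue β X :=
  Real.sInf_nonneg (by rintro _ ⟨x, _, rfl⟩; exact orderedNorm_nonneg hβ x)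

theorem le_optValue (hf : IsApproxOracle τ X f) {a : ℝ}
    (h : ∀ x ∈ feasible X, a ≤ orderedNorm β x) : a ≤ optValue β X :=
  le_csInf ⟨_, _, sum_oracle_mem_feasible hf 0, rfl⟩ (by rintro _ ⟨x, hx, rfl⟩; exact h x hx)

/-- Weak duality: oracle answers for prices in the dual unit ball bound the optimum value. -/
theorem oracle_cost_le (hτ : 0 < τ) (hX : IsInstance X) (hf : IsApproxOracle τ X f)
    (y : Fin d → ℝ≥0) {b : ℝ}
    (hy : ∀ z ∈ orthant d, ∑ i, z i * (y i : ℝ) ≤ b * orderedNorm β z) (hb : 0 < b) :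
    ∑ c, ∑ i, f c y i * (y i : ℝ) ≤ τ * (b * optValue β X) := by
  have : (∑ c, ∑ i, f c y i * (y i : ℝ)) / (τ * b) ≤ optValue β X := by
    refine le_optValue hf fun x hx => ?_
    rw [div_le_iff₀ (by positivity)]
    have hxo := feasible_subset_orthant hX hx
    have h1 := hy x hxo
    obtain ⟨z, hz, rfl⟩ := hx
    have h2 : ∑ c, ∑ i, f c y i * (y i : ℝ) ≤ ∑ c, τ * ∑ i, z c i * (y i : ℝ) :=
      Finset.sum_le_sum fun c _ => (hf c y).2 _ (hz c)
    have h3 : ∑ c, τ * ∑ i, z c i * (y i : ℝ) = τ * ∑ i, (∑ c, z c) i * (y i : ℝ) := by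
      rw [← Finset.mul_sum, Finset.sum_comm]
      simp only [Finset.sum_apply, Finset.sum_mul]
    rw [h3] at h2
    calc _ ≤ _ := h2
      _ ≤ τ * (b * orderedNorm β (∑ c, z c)) := mul_le_mul_of_nonneg_left h1 hτ.le
      _ = _ := by ring
  rw [div_le_iff₀ (by positivity)] at this
  linarith

end OptValue

/-! ### Execution of query blocks. -/

section Semantics

variable {n d : ℕ}

/-- Query the oracles of all customers in the list `l` at the prices `y`. -/
def callList (y : Fin d → ℝ≥0) (next : (Fin n → Fin d → ℝ) → Algorithm n d) :
    List (Fin n) → (Fin n → Fin d → ℝ) → Algorithm n d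
  | [], B => next B
  | c :: l, B => .callOracle c y fun b => callList y next l (Function.update B c b)

/-- Query the oracles of all customers at the prices `y`. -/
def callAll (y : Fin d → ℝ≥0) (next : (Fin n → Fin d → ℝ) → Algorithm n d) : Algorithm n d :=
  callList y next (List.finRange n) 0

variable (f : Fin n → (Fin d → ℝ≥0) → (Fin d → ℝ)) (g : (Fin d → ℝ) → (Fin d → ℝ))

/-- The outcome with `a` more oracle calls and `b` more gradient evaluations. -/
def Outcome.shift (a b : ℕ) (r : Outcome d) : Outcome d :=
  ⟨r.solution, r.oracleCalls + a, r.gradEvals + b⟩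

theorem Outcome.shift_zero : Outcome.shift 0 0 = (id : Outcome d → Outcome d) := rfl

theorem Outcome.shift_comp (a b a' b' : ℕ) :
    (Outcome.shift a b ∘ Outcome.shift a' b' : Outcome d → Outcome d) =
      Outcome.shift (a' + a) (b' + b) := by
  funext r
  simp [Outcome.shift, add_assoc]

theorem run_callOracle (c : Fin n) (y : Fin d → ℝ≥0) (next : (Fin d → ℝ) → Algorithm n d) :
    (Algorithm.callOracle c y next).run f g =
      ((next (f c y)).run f g).map (Outcome.shift 1 0) := rfl

theorem run_evalGrad (x : Fin d → ℝ≥0) (next : (Fin d → ℝ) → Algorithm n d) :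
    (Algorithm.evalGrad x next).run f g =
      ((next (g fun i => (x i : ℝ))).run f g).map (Outcome.shift 0 1) := rfl

theorem run_callList (y : Fin d → ℝ≥0) (next : (Fin n → Fin d → ℝ) → Algorithm n d)
    (l : List (Fin n)) (B : Fin n → Fin d → ℝ) :
    (callList y next l B).run f g =
      ((next fun c => if c ∈ l then f c y else B c).run f g).map (Outcome.shift l.length 0) := by
  induction l generalizing B with
  | nil => simp [callList, Outcome.shift_zero, PMF.map_id]
  | cons c l ih =>
    rw [callList, run_callOracle, ih, PMF.map_comp, Outcome.shift_comp]
    congr 3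
    funext c'
    by_cases h1 : c' = c
    · subst h1; simp
    · simp [h1]

theorem run_callAll (y : Fin d → ℝ≥0) (next : (Fin n → Fin d → ℝ) → Algorithm n d) :
    (callAll y next).run f g =
      ((next fun c => f c y).run f g).map (Outcome.shift n 0) := by
  rw [callAll, run_callList]
  simp

end Semantics

/-! ### States and their transitions. -/

/-- The parameters of the algorithm: the approximation factor of the oracles, the progress per
iteration, the relative increase of the guess of the optimum, and the scale of the potential. -/
structure Params where
  τ : ℝ
  gain : ℝ
  incr : ℝ
  scale : ℝ

/-- The state of the algorithm: a guess of the optimum, the total load (in units of the guess at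
the time of each step), the progress of each customer and its accumulated oracle answers, and the
two accumulated deviations from the expectation. -/
structure State (n d : ℕ) where
  guess : ℝ
  load : Fin d → ℝ≥0
  progress : Fin n → ℝ
  alloc : Fin n → Fin d → ℝ
  costErr : ℝ
  gainErr : ℝ

/-- The cost of a vector at given prices. -/
def cost (b : Fin d → ℝ) (y : Fin d → ℝ≥0) : ℝ := ∑ i, b i * (y i : ℝ)

namespace State

variable {n d : ℕ} (P : Params) (s : State n d)

/-- The covering weight of a customer, which decreases with its progress. -/
def share (c : Fin n) : ℝ := Real.exp (-s.progress c) / ∑ c', Real.exp (-s.progress c')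

/-- The probability of sampling a customer. -/
def prob (c : Fin n) : ℝ := (s.share c + 1 / n) / 2

/-- The gain of a customer relative to its probability. -/
def relGain (c : Fin n) : ℝ := s.share c / s.prob c

/-- The cost of an answer relative to the guess and the probability of the customer. -/
def relCost (y : Fin d → ℝ≥0) (c : Fin n) (b : Fin d → ℝ) : ℝ :=
  cost b y / (s.guess * s.prob c)

/-- The size of a step, damped so that the load changes by at most one. -/
def stepSize (c : Fin n) (b : Fin d → ℝ) : ℝ :=
  P.gain / s.prob c / (1 + P.gain / s.prob c * ‖s.guess⁻¹ • b‖)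

/-- Process the answer `b` of customer `c` for the prices `y`: a step is made unless the answer
is too expensive. -/
def step (y : Fin d → ℝ≥0) (c : Fin n) (b : Fin d → ℝ) : State n d where
  guess := s.guess
  load := if s.relCost y c b ≤ 4 * P.τ then
    fun i => s.load i + (s.stepSize P c b * (s.guess⁻¹ * b i)).toNNReal else s.load
  progress := if s.relCost y c b ≤ 4 * P.τ then
    Function.update s.progress c (s.progress c + s.stepSize P c b) else s.progress
  alloc := if s.relCost y c b ≤ 4 * P.τ then
    Function.update s.alloc c (s.alloc c + s.stepSize P c b • b) else s.alloc
  costErr := s.costErr + (min (s.relCost y c b) (4 * P.τ) - P.τ)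
  gainErr := s.gainErr + (1 - s.relGain c)

/-- Increase the guess of the optimum. -/
def raise : State n d :=
  { s with guess := s.guess * (1 + P.incr), costErr := s.costErr - 12 * P.τ * n }

/-- The potential that measures the deviations. -/
def potential : ℝ := Real.exp (P.scale * s.costErr) + Real.exp (P.scale * s.gainErr)

open Classical in
/-- Process the answers of all customers for the prices `y`: either they prove that the guess is
too small, or we make the step that is best for the potential. -/
def probe (y : Fin d → ℝ≥0) (B : Fin n → Fin d → ℝ) : State n d :=
  if P.τ * s.guess < ∑ c, cost (B c) y then s.raise P
  else if h : ∃ c, ∀ c', (s.step P y c (B c)).potential P ≤ (s.step P y c' (B c')).potential P then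
    s.step P y h.choose (B h.choose)
  else s

theorem sum_exp_pos [NeZero n] : 0 < ∑ c, Real.exp (-s.progress c) :=
  Finset.sum_pos (fun _ _ => Real.exp_pos _) Finset.univ_nonempty

theorem share_pos [NeZero n] (c : Fin n) : 0 < s.share c :=
  div_pos (Real.exp_pos _) s.sum_exp_pos

theorem sum_share [NeZero n] : ∑ c, s.share c = 1 := by
  simp only [share]
  rw [← Finset.sum_div, div_self s.sum_exp_pos.ne']

theorem prob_pos [NeZero n] (c : Fin n) : 0 < s.prob c :=
  div_pos (add_pos_of_pos_of_nonneg (s.share_pos c) (by positivity)) two_pos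

theorem sum_prob [NeZero n] : ∑ c, s.prob c = 1 := by
  have hn : (n : ℝ) ≠ 0 := Nat.cast_ne_zero.mpr (NeZero.ne n)
  simp only [prob]
  rw [← Finset.sum_div, Finset.sum_add_distrib, sum_share]
  simp only [Finset.sum_const, Finset.card_univ, Fintype.card_fin, nsmul_eq_mul]
  field_simp
  norm_num

/-- The distribution for sampling customers. -/
def dist [NeZero n] : PMF (Fin n) :=
  PMF.ofFintype (fun c => ENNReal.ofReal (s.prob c)) (by
    rw [← ENNReal.ofReal_sum_of_nonneg fun c _ => (s.prob_pos c).le, sum_prob, ENNReal.ofReal_one])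

end State

/-! ### The deterministic and the randomized loop. -/

section Loops

variable {n d : ℕ} (P : Params)

/-- The prices for a given gradient. -/
def toPrices (v : Fin d → ℝ) : Fin d → ℝ≥0 := fun i => (v i).toNNReal

/-- `N` iterations that query all customers each. -/
def detLoop (next : State n d → Algorithm n d) : ℕ → State n d → Algorithm n d
  | 0, s => next s
  | N + 1, s => .evalGrad s.load fun v =>
      callAll (toPrices v) fun B => detLoop next N (s.probe P (toPrices v) B)

/-- `N` iterations that query all customers with probability `1 / (n + 1)` and otherwise only one
random customer. -/
def randLoop [NeZero n] (next : State n d → Algorithm n d) : ℕ → State n d → Algorithm n d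
  | 0, s => next s
  | N + 1, s => .evalGrad s.load fun v =>
      .choose (n + 1) (PMF.uniformOfFintype (Fin (n + 1))) fun i =>
        if i = 0 then callAll (toPrices v) fun B => randLoop next N (s.probe P (toPrices v) B)
        else .choose n s.dist fun c => .callOracle c (toPrices v) fun b =>
          randLoop next N (s.step P (toPrices v) c b)

variable (f : Fin n → (Fin d → ℝ≥0) → (Fin d → ℝ)) (g : (Fin d → ℝ) → (Fin d → ℝ))

/-- The prices at a state. -/
def State.prices (s : State n d) : Fin d → ℝ≥0 := toPrices (g fun i => (s.load i : ℝ))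

/-- The next state if customer `c` is sampled. -/
def State.sampleNext (s : State n d) (c : Fin n) : State n d :=
  s.step P (s.prices g) c (f c (s.prices g))

/-- The next state if all customers are queried. -/
def State.probeNext (s : State n d) : State n d :=
  s.probe P (s.prices g) fun c => f c (s.prices g)

theorem run_detLoop (next : State n d → Algorithm n d) (N : ℕ) (s : State n d) :
    (detLoop P next N s).run f g =
      ((next ((State.probeNext P f g)^[N] s)).run f g).map (Outcome.shift (N * n) N) := by
  induction N generalizing s with
  | zero => simp [detLoop, Outcome.shift_zero, PMF.map_id]
  | succ N ih =>
    rw [detLoop, run_evalGrad, run_callAll, ih, PMF.map_comp, PMF.map_comp, Outcome.shift_comp,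
      Outcome.shift_comp, Function.iterate_succ_apply]
    congr 2
    ring

/-- Transfers an invariant to every execution path, for the guarantees that hold surely. Either kind
of iteration makes at most n oracle calls. -/
theorem exists_of_mem_support_randLoop [NeZero n] (next : State n d → Algorithm n d)
    {I : ℕ → State n d → Prop} (hs : ∀ k s c, I k s → I (k + 1) (s.sampleNext P f g c))
    (hp : ∀ k s, I k s → I (k + 1) (s.probeNext P f g)) (N k : ℕ) (s : State n d) (h : I k s)
    {r : Outcome d} (hr : r ∈ ((randLoop P next N s).run f g).support) :
    ∃ s', I (k + N) s' ∧ ∃ r' ∈ ((next s').run f g).support, r.solution = r'.solution ∧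
      r.gradEvals = r'.gradEvals + N ∧ r.oracleCalls ≤ r'.oracleCalls + N * n := by
  induction N generalizing k s r with
  | zero => exact ⟨s, h, r, hr, rfl, rfl, by simp⟩
  | succ N ih =>
    have hn : 1 ≤ n := NeZero.one_le
    rw [randLoop, run_evalGrad, PMF.support_map] at hr
    obtain ⟨r₁, hr₁, rfl⟩ := hr
    simp only [Algorithm.run, PMF.mem_support_bind_iff] at hr₁
    obtain ⟨i, -, hr₁⟩ := hr₁
    split_ifs at hr₁ with hi
    · rw [run_callAll, PMF.support_map] at hr₁
      obtain ⟨r₂, hr₂, rfl⟩ := hr₁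
      obtain ⟨s', hI, r', hr', h1, h2, h3⟩ := ih (k + 1) _ (hp k s h) hr₂
      refine ⟨s', by rwa [add_right_comm, add_assoc] at hI, r', hr', h1, ?_, ?_⟩
      · simp only [Outcome.shift]; omega
      · simp only [Outcome.shift, add_mul]; omega
    · simp only [Algorithm.run, PMF.mem_support_bind_iff, PMF.support_map] at hr₁
      obtain ⟨c, -, r₂, hr₂, rfl⟩ := hr₁
      obtain ⟨s', hI, r', hr', h1, h2, h3⟩ := ih (k + 1) _ (hs k s c h) hr₂
      refine ⟨s', by rwa [add_right_comm, add_assoc] at hI, r', hr', h1, ?_, ?_⟩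
      · simp only [Outcome.shift]; omega
      · simp only [Outcome.shift, add_mul]; omega

/-- The probability that the outcome of an algorithm has a property. -/
def Algorithm.prob (A : Algorithm n d) (E : Set (Outcome d)) : ℝ≥0∞ :=
  (A.run f g).toOuterMeasure E

theorem prob_randLoop_succ [NeZero n] (next : State n d → Algorithm n d) (N : ℕ) (s : State n d)
    (E : Set (Outcome d)) :
    (randLoop P next (N + 1) s).prob f g E =
      (n + 1 : ℝ≥0∞)⁻¹ * ((randLoop P next N (s.probeNext P f g)).prob f g
        (Outcome.shift n 1 ⁻¹' E) +
        n * ∑ c, ENNReal.ofReal (s.prob c) *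
          (randLoop P next N (s.sampleNext P f g c)).prob f g (Outcome.shift 1 1 ⁻¹' E)) := by
  simp only [Algorithm.prob]
  rw [randLoop, run_evalGrad, PMF.toOuterMeasure_map_apply]
  simp only [Algorithm.run]
  rw [PMF.toOuterMeasure_bind_apply, tsum_fintype, Fin.sum_univ_succ, mul_add]
  simp only [PMF.uniformOfFintype_apply, Fintype.card_fin, Nat.cast_add, Nat.cast_one,
    if_true, Fin.succ_ne_zero, if_false]
  congr 1
  · rw [run_callAll, PMF.toOuterMeasure_map_apply]
    rfl
  · rw [Finset.sum_const, Finset.card_univ, Fintype.card_fin, nsmul_eq_mul, mul_left_comm]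
    congr 2
    rw [Algorithm.run, PMF.toOuterMeasure_bind_apply, tsum_fintype]
    refine Finset.sum_congr rfl fun c _ => ?_
    rw [run_callOracle, PMF.toOuterMeasure_map_apply]
    rfl

end Loops

/-! ### Pathwise invariants. -/

/-- The assumptions on the norm, the instance, the oracles and the parameters. -/
structure IsSetting {n d : ℕ} (P : Params) (β : Fin d → ℝ) (Ψ : (Fin d → ℝ) → ℝ)
    (X : Fin n → Set (Fin d → ℝ)) (f : Fin n → (Fin d → ℝ≥0) → (Fin d → ℝ)) : Prop where
  one_le_τ : 1 ≤ P.τ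
  weight : IsOrderedWeight β
  approx : IsNormApprox β Ψ (Real.log d) 1
  inst : IsInstance X
  oracle : IsApproxOracle P.τ X f
  gain_pos : 0 < P.gain
  incr_pos : 0 < P.incr

namespace State

variable {n d : ℕ} {P : Params} (s : State n d)

/-- The soft minimum of the progress of the customers. -/
def softMin : ℝ := -Real.log (∑ c, Real.exp (-s.progress c))

/-- The load as a real vector. -/
def loadVec : Fin d → ℝ := fun i => (s.load i : ℝ)

theorem loadVec_mem : s.loadVec ∈ orthant d := fun i => (s.load i).2

theorem softMin_le [NeZero n] (c : Fin n) : s.softMin ≤ s.progress c := by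
  have h : Real.exp (-s.progress c) ≤ ∑ c, Real.exp (-s.progress c) :=
    Finset.single_le_sum (f := fun c => Real.exp (-s.progress c))
      (fun _ _ => (Real.exp_pos _).le) (Finset.mem_univ c)
  have := (Real.le_log_iff_exp_le s.sum_exp_pos).2 h
  rw [softMin]
  linarith

theorem relGain_nonneg [NeZero n] (c : Fin n) : 0 ≤ s.relGain c :=
  div_nonneg (s.share_pos c).le (s.prob_pos c).le

/-- The shares form one half of the sampling distribution, which bounds the gain. The uniform half
bounds 1/prob, and hence the step size. -/
theorem relGain_le_two [NeZero n] (c : Fin n) : s.relGain c ≤ 2 := by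
  have h : (0 : ℝ) ≤ 1 / n := by positivity
  rw [relGain, div_le_iff₀ (s.prob_pos c), prob]
  linarith

theorem sum_prob_mul_relGain [NeZero n] : ∑ c, s.prob c * s.relGain c = 1 := by
  rw [← s.sum_share]
  exact Finset.sum_congr rfl fun c _ => mul_div_cancel₀ _ (s.prob_pos c).ne'

theorem inv_prob_le [NeZero n] (c : Fin n) : (s.prob c)⁻¹ ≤ 2 * n := by
  have hn : (0 : ℝ) < n := Nat.cast_pos.mpr (NeZero.pos n)
  have h := s.share_pos c
  rw [inv_le_comm₀ (s.prob_pos c) (by positivity), prob]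
  have : (2 * (n : ℝ))⁻¹ = 1 / n / 2 := by field_simp
  rw [this]
  linarith

/-- The change of the soft minimum if a single customer makes progress. -/
theorem softMin_update [NeZero n] (t : State n d) {c : Fin n} {ξ : ℝ} (hξ : 0 ≤ ξ)
    (ht : t.progress = Function.update s.progress c (s.progress c + ξ)) :
    s.softMin + s.share c * ξ * (1 - ξ) ≤ t.softMin := by
  set W := ∑ c, Real.exp (-s.progress c) with hW
  have hWpos : 0 < W := s.sum_exp_pos
  have hz := s.share_pos c
  have hsum : ∑ c, Real.exp (-t.progress c) = W * (1 - s.share c * (1 - Real.exp (-ξ))) := by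
    have h1 : ∑ c', (Real.exp (-t.progress c') - Real.exp (-s.progress c')) =
        Real.exp (-t.progress c) - Real.exp (-s.progress c) := by
      refine Finset.sum_eq_single c (fun c' _ hc' => ?_) (by simp)
      rw [ht, Function.update_of_ne hc', sub_self]
    rw [Finset.sum_sub_distrib, ← hW, ht, Function.update_self, ← ht, neg_add,
      Real.exp_add] at h1
    have h2 : W * s.share c = Real.exp (-s.progress c) := mul_div_cancel₀ _ hWpos.ne'
    linear_combination h1 + (1 - Real.exp (-ξ)) * h2
  have htpos : 0 < ∑ c, Real.exp (-t.progress c) := t.sum_exp_pos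
  have hpos : 0 < 1 - s.share c * (1 - Real.exp (-ξ)) := by
    rw [hsum] at htpos
    exact (mul_pos_iff_of_pos_left hWpos).1 htpos
  have hlog := Real.log_le_sub_one_of_pos hpos
  -- From exp(-ξ) ≤ 1/(1+ξ) ≤ 1 - ξ + ξ².
  have he : ξ * (1 - ξ) ≤ 1 - Real.exp (-ξ) := by
    have h1 := Real.add_one_le_exp ξ
    have h2 : Real.exp (-ξ) ≤ (1 + ξ)⁻¹ := by
      rw [Real.exp_neg]
      exact inv_anti₀ (by linarith) (by linarith)
    have h3 : (1 + ξ)⁻¹ ≤ 1 - ξ * (1 - ξ) := by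
      rw [inv_le_iff_one_le_mul₀ (by linarith)]
      nlinarith [pow_nonneg hξ 3]
    linarith
  have h4 := mul_le_mul_of_nonneg_left he hz.le
  simp only [softMin]
  rw [hsum, Real.log_mul hWpos.ne' hpos.ne', ← hW]
  linarith

section StepSize

variable (c : Fin n) (b : Fin d → ℝ)

theorem stepSize_denom_pos [NeZero n] (hg : 0 < P.gain) :
    0 < 1 + P.gain / s.prob c * ‖s.guess⁻¹ • b‖ :=
  add_pos_of_pos_of_nonneg one_pos
    (mul_nonneg (div_pos hg (s.prob_pos c)).le (norm_nonneg _))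

theorem stepSize_pos [NeZero n] (hg : 0 < P.gain) : 0 < s.stepSize P c b :=
  div_pos (div_pos hg (s.prob_pos c)) (s.stepSize_denom_pos c b hg)

/-- The damped size is the fixed point for which the undamped size shrinks by exactly 1 - ‖v‖, where
v is the resulting change of the load. -/
theorem stepSize_eq [NeZero n] (hg : 0 < P.gain) :
    s.stepSize P c b = P.gain / s.prob c * (1 - s.stepSize P c b * ‖s.guess⁻¹ • b‖) := by
  have h := (s.stepSize_denom_pos c b hg).ne'
  rw [stepSize]
  generalize P.gain / s.prob c = a at *
  generalize ‖s.guess⁻¹ • b‖ = m at *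
  field_simp
  ring

theorem stepSize_le [NeZero n] (hg : 0 < P.gain) : s.stepSize P c b ≤ 2 * n * P.gain := by
  have h1 := s.stepSize_eq c b hg
  have h2 : 0 ≤ s.stepSize P c b * ‖s.guess⁻¹ • b‖ :=
    mul_nonneg (s.stepSize_pos c b hg).le (norm_nonneg _)
  have h3 : P.gain / s.prob c ≤ 2 * n * P.gain := by
    rw [div_eq_mul_inv, mul_comm]
    exact mul_le_mul_of_nonneg_right (s.inv_prob_le c) hg.le
  have h4 : 0 < P.gain / s.prob c := div_pos hg (s.prob_pos c)
  have h5 := mul_nonneg h4.le h2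
  rw [h1]
  linarith

end StepSize

/-- The invariants after `R` increases of the guess and `N` steps, where `J` counts the steps with
an answer that was too expensive, and `μ₀` is the initial guess. -/
structure Inv (P : Params) (β : Fin d → ℝ) (Ψ : (Fin d → ℝ) → ℝ) (X : Fin n → Set (Fin d → ℝ))
    (μ₀ : ℝ) (s : State n d) (R N : ℕ) (J : ℝ) : Prop where
  rejected_nonneg : 0 ≤ J
  guess_eq : s.guess = μ₀ * (1 + P.incr) ^ R
  guess_le : s.guess ≤ (1 + P.incr) * optValue β X
  alloc_mem : ∀ c, (s.progress c = 0 ∧ s.alloc c = 0) ∨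
    (0 < s.progress c ∧ (s.progress c)⁻¹ • s.alloc c ∈ X c)
  alloc_le : ∀ i, ∑ c, s.alloc c i ≤ s.guess * s.loadVec i
  approx_le : Ψ s.loadVec + 4 * P.gain * P.τ * J ≤
    Real.log d + P.gain * (P.τ * N + s.costErr + 12 * P.τ * n * R)
  le_softMin : -Real.log n + P.gain * (1 - 2 * n * P.gain) * (N - s.gainErr) ≤
    s.softMin + 2 * P.gain * ∑ i, s.loadVec i + 2 * P.gain * J

section Preservation

variable {β : Fin d → ℝ} {Ψ : (Fin d → ℝ) → ℝ} {X : Fin n → Set (Fin d → ℝ)}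
  {f : Fin n → (Fin d → ℝ≥0) → (Fin d → ℝ)} {μ₀ : ℝ} {s : State n d} {R N : ℕ} {J : ℝ}

theorem coe_prices (hS : IsSetting P β Ψ X f) (s : State n d) (i : Fin d) :
    (s.prices (orthantGrad Ψ) i : ℝ) = orthantGrad Ψ s.loadVec i :=
  Real.coe_toNNReal _ (hS.approx.grad_nonneg hS.weight zero_le_one s.loadVec_mem i)

theorem cost_nonneg (hS : IsSetting P β Ψ X f) (c : Fin n) (y : Fin d → ℝ≥0) :
    0 ≤ cost (f c y) y :=
  Finset.sum_nonneg fun i _ =>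
    mul_nonneg (hS.inst.subset_orthant c (hS.oracle c y).1 i) (y i).2

theorem sum_cost_le (hS : IsSetting P β Ψ X f) (s : State n d) :
    ∑ c, cost (f c (s.prices (orthantGrad Ψ))) (s.prices (orthantGrad Ψ)) ≤
      P.τ * optValue β X := by
  have h := oracle_cost_le (β := β) (lt_of_lt_of_le one_pos hS.one_le_τ) hS.inst hS.oracle
    (s.prices (orthantGrad Ψ)) (b := 1) (fun z hz => by
      simp only [coe_prices hS]
      rw [one_mul]
      exact hS.approx.grad_inner_le hS.weight s.loadVec_mem hz) one_pos
  rwa [one_mul] at h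

/-- By weak duality the violated cost bound certifies that the old guess is below OPT. The load need
not be rescaled: a larger guess only weakens `alloc_le`. -/
theorem Inv.raise (hS : IsSetting P β Ψ X f) (h : Inv P β Ψ X μ₀ s R N J)
    (hlt : P.τ * s.guess < ∑ c, cost (f c (s.prices (orthantGrad Ψ))) (s.prices (orthantGrad Ψ)))
    (hμ : 0 < s.guess) : Inv P β Ψ X μ₀ (s.raise P) (R + 1) N J where
  rejected_nonneg := h.rejected_nonneg
  guess_eq := by
    simp only [State.raise, h.guess_eq, pow_succ]
    ring
  guess_le := by
    have h1 := hlt.trans_le (sum_cost_le hS s)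
    have h2 : s.guess ≤ optValue β X :=
      (lt_of_mul_lt_mul_left h1 (zero_le_one.trans hS.one_le_τ)).le
    simp only [State.raise]
    rw [mul_comm]
    exact mul_le_mul_of_nonneg_left h2 (by linarith [hS.incr_pos])
  alloc_mem := h.alloc_mem
  alloc_le i := by
    refine (h.alloc_le i).trans ?_
    have h1 : 0 ≤ s.guess * s.loadVec i * P.incr :=
      mul_nonneg (mul_nonneg hμ.le (s.loadVec_mem i)) hS.incr_pos.le
    have h2 : (s.raise P).guess * (s.raise P).loadVec i =
        s.guess * (1 + P.incr) * s.loadVec i := rfl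
    rw [h2]
    linarith
  approx_le := by
    have h1 := h.approx_le
    have h2 : (s.raise P).loadVec = s.loadVec := rfl
    rw [h2]
    simp only [State.raise]
    push_cast
    linarith
  le_softMin := h.le_softMin

theorem loadVec_step (hμ : 0 < s.guess) [NeZero n] (hg : 0 < P.gain) {y : Fin d → ℝ≥0} {c : Fin n}
    {b : Fin d → ℝ} (hb : b ∈ orthant d) (hacc : s.relCost y c b ≤ 4 * P.τ) :
    (s.step P y c b).loadVec = s.loadVec + s.stepSize P c b • (s.guess⁻¹ • b) := by
  funext i
  simp only [loadVec, step, if_pos hacc, NNReal.coe_add, Pi.add_apply, Pi.smul_apply, smul_eq_mul]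
  rw [Real.coe_toNNReal]
  exact mul_nonneg (s.stepSize_pos c b hg).le (mul_nonneg (inv_nonneg.2 hμ.le) (hb i))

theorem norm_le_sum {v : Fin d → ℝ} (hv : v ∈ orthant d) : ‖v‖ ≤ ∑ i, v i := by
  refine (pi_norm_le_iff_of_nonneg (Finset.sum_nonneg fun i _ => hv i)).2 fun i => ?_
  rw [Real.norm_of_nonneg (hv i)]
  exact Finset.single_le_sum (f := v) (fun i _ => hv i) (Finset.mem_univ i)

theorem Inv.step_of_le [NeZero n] (hS : IsSetting P β Ψ X f) (h : Inv P β Ψ X μ₀ s R N J)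
    (hμ : 0 < s.guess) (c : Fin n)
    (hacc : s.relCost (s.prices (orthantGrad Ψ)) c (f c (s.prices (orthantGrad Ψ))) ≤ 4 * P.τ) :
    Inv P β Ψ X μ₀ (s.sampleNext P f (orthantGrad Ψ) c) R (N + 1) J := by
  have hg := hS.gain_pos
  set y := s.prices (orthantGrad Ψ) with hy
  set b := f c y with hbdef
  have hbX : b ∈ X c := (hS.oracle c y).1
  have hb : b ∈ orthant d := hS.inst.subset_orthant c hbX
  set ξ := s.stepSize P c b with hξ
  have hξpos : 0 < ξ := s.stepSize_pos c b hg
  set v : Fin d → ℝ := ξ • (s.guess⁻¹ • b) with hv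
  have hvo : v ∈ orthant d :=
    smul_mem_orthant hξpos.le (smul_mem_orthant (inv_nonneg.2 hμ.le) hb)
  have hload : (s.step P y c b).loadVec = s.loadVec + v := loadVec_step hμ hg hb hacc
  have hnorm : ‖v‖ = ξ * ‖s.guess⁻¹ • b‖ := by
    rw [hv, norm_smul, Real.norm_of_nonneg hξpos.le]
  have hξeq : ξ = P.gain / s.prob c * (1 - ‖v‖) := by
    rw [hnorm]
    exact s.stepSize_eq c b hg
  have hqpos := s.prob_pos c
  have hsample : s.sampleNext P f (orthantGrad Ψ) c = s.step P y c b := rfl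
  rw [hsample]
  refine ⟨h.rejected_nonneg, h.guess_eq, h.guess_le, ?_, ?_, ?_, ?_⟩
  · intro c'
    simp only [State.step, if_pos hacc]
    by_cases hc : c' = c
    · subst hc
      rw [Function.update_self, Function.update_self, ← hξ]
      right
      rcases h.alloc_mem c' with ⟨h1, h2⟩ | ⟨h1, h2⟩
      · rw [h1, h2, zero_add, zero_add, smul_smul, inv_mul_cancel₀ hξpos.ne', one_smul]
        exact ⟨hξpos, hbX⟩
      · have hpos : 0 < s.progress c' + ξ := by positivity
        refine ⟨hpos, ?_⟩
        have := hS.inst.convex c' h2 hbX (a := s.progress c' / (s.progress c' + ξ))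
          (b := ξ / (s.progress c' + ξ)) (by positivity) (by positivity) (by field_simp)
        convert this using 1
        rw [smul_smul, smul_add, smul_smul]
        congr 2 <;> field_simp
    · rw [Function.update_of_ne hc, Function.update_of_ne hc]
      exact h.alloc_mem c'
  · intro i
    rw [hload]
    have h1 : ∑ c', (s.step P y c b).alloc c' i = ∑ c', s.alloc c' i + ξ * b i := by
      have h2 : ∑ c', ((s.step P y c b).alloc c' i - s.alloc c' i) = ξ * b i := by
        rw [Finset.sum_eq_single c]
        · simp [State.step, if_pos hacc, ← hξ]
        · intro c' _ hc
          simp [State.step, if_pos hacc, hc]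
        · simp
      rw [Finset.sum_sub_distrib] at h2
      linarith
    have h3 : s.guess * v i = ξ * b i := by
      simp only [hv, Pi.smul_apply, smul_eq_mul]
      field_simp
    rw [h1, Pi.add_apply]
    have h4 : (s.step P y c b).guess = s.guess := rfl
    rw [h4, mul_add, h3]
    linarith [h.alloc_le i]
  · rw [hload]
    have h1 := hS.approx.le_add_exp_mul s.loadVec_mem hvo
    set ρ := s.relCost y c b with hρ
    have hρ0 : 0 ≤ ρ := div_nonneg (cost_nonneg hS c y) (mul_pos hμ hqpos).le
    have h2 : ∑ i, v i * orthantGrad Ψ s.loadVec i = (1 - ‖v‖) * (P.gain * ρ) := by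
      have h3 : ∑ i, v i * orthantGrad Ψ s.loadVec i = ξ * (s.guess⁻¹ * cost b y) := by
        rw [cost, Finset.mul_sum, Finset.mul_sum]
        refine Finset.sum_congr rfl fun i _ => ?_
        rw [hy, coe_prices hS, hv]
        simp only [Pi.smul_apply, smul_eq_mul]
        ring
      rw [h3, hξeq, hρ, relCost]
      field_simp
    -- The damping factor compensates for the growth of the prices along the step.
    have h4 : Real.exp ‖v‖ * (1 - ‖v‖) ≤ 1 := by
      have := mul_le_mul_of_nonneg_left (Real.one_sub_le_exp_neg ‖v‖) (Real.exp_pos ‖v‖).le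
      rwa [← Real.exp_add, add_neg_cancel, Real.exp_zero] at this
    have h5 := mul_le_mul_of_nonneg_right h4 (mul_nonneg hg.le hρ0)
    have h6 : (s.step P y c b).costErr = s.costErr + (ρ - P.τ) := by
      simp only [State.step]
      rw [← hρ, min_eq_left hacc]
    rw [h2] at h1
    rw [h6]
    push_cast
    linarith [h.approx_le]
  · have h1 := s.softMin_update (s.step P y c b) hξpos.le (c := c)
      (by simp only [State.step, if_pos hacc]; rfl)
    have h2 : ∑ i, (s.step P y c b).loadVec i = ∑ i, s.loadVec i + ∑ i, v i := by
      rw [hload, ← Finset.sum_add_distrib]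
      rfl
    have h3 := norm_le_sum hvo
    have h4 : (s.step P y c b).gainErr = s.gainErr + (1 - s.relGain c) := rfl
    have h5 : ξ ≤ 2 * n * P.gain := s.stepSize_le c b hg
    have hz := s.share_pos c
    have h6 : s.share c * ξ * (1 - 2 * n * P.gain) ≤ s.share c * ξ * (1 - ξ) :=
      mul_le_mul_of_nonneg_left (by linarith) (by positivity)
    have h7 : s.share c * ξ = P.gain * s.relGain c * (1 - ‖v‖) := by
      rw [hξeq, relGain]
      field_simp
    have hw0 := s.relGain_nonneg c
    have hw2 := s.relGain_le_two c
    -- The progress lost by damping is charged to the increase of the total load.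
    have h8 : P.gain * s.relGain c * ‖v‖ * (1 - 2 * n * P.gain) ≤ 2 * P.gain * ‖v‖ := by
      have e1 : P.gain * s.relGain c * ‖v‖ ≤ P.gain * 2 * ‖v‖ := by gcongr
      have e2 : 0 ≤ P.gain * s.relGain c * ‖v‖ := by positivity
      have e3 : 0 ≤ 2 * n * P.gain := by positivity
      have e4 := mul_nonneg e2 e3
      linarith
    have h9 := mul_le_mul_of_nonneg_left h3 (mul_pos two_pos hg).le
    rw [h2, h4]
    rw [h7] at h6
    have h10 := h.le_softMin
    push_cast
    rw [h7] at h1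
    linarith

/-- Load and progress stay put. The accounted cost 4τ pays for the new rejection in `approx_le`, and
the missing gain of at most 2 is covered by the new rejection in `le_softMin`. -/
theorem Inv.step_of_lt [NeZero n] (hS : IsSetting P β Ψ X f) (h : Inv P β Ψ X μ₀ s R N J)
    (c : Fin n)
    (hrej : 4 * P.τ < s.relCost (s.prices (orthantGrad Ψ)) c (f c (s.prices (orthantGrad Ψ)))) :
    Inv P β Ψ X μ₀ (s.sampleNext P f (orthantGrad Ψ) c) R (N + 1) (J + 1) := by
  set y := s.prices (orthantGrad Ψ) with hy
  set b := f c y with hbdef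
  have hsample : s.sampleNext P f (orthantGrad Ψ) c = s.step P y c b := rfl
  have hn := not_le.2 hrej
  have hg := hS.gain_pos
  have hp : (s.step P y c b).progress = s.progress := by simp only [State.step, if_neg hn]
  have ha : (s.step P y c b).alloc = s.alloc := by simp only [State.step, if_neg hn]
  have hl : (s.step P y c b).loadVec = s.loadVec := by
    funext i
    simp only [loadVec, State.step, if_neg hn]
  have hq : (s.step P y c b).softMin = s.softMin := by simp only [softMin, hp]
  have hgs : (s.step P y c b).guess = s.guess := rfl
  rw [hsample]
  refine ⟨by linarith [h.rejected_nonneg], h.guess_eq, h.guess_le, ?_, ?_, ?_, ?_⟩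
  · rw [hp, ha]
    exact h.alloc_mem
  · rw [ha, hl, hgs]
    exact h.alloc_le
  · have h1 : (s.step P y c b).costErr = s.costErr + (4 * P.τ - P.τ) := by
      simp only [State.step]
      rw [min_eq_right hrej.le]
    rw [hl, h1]
    push_cast
    linarith [h.approx_le]
  · have h4 : (s.step P y c b).gainErr = s.gainErr + (1 - s.relGain c) := rfl
    rw [hl, hq, h4]
    have hw0 := s.relGain_nonneg c
    have hw2 := s.relGain_le_two c
    have e1 : P.gain * s.relGain c ≤ P.gain * 2 := by gcongr
    have e2 : 0 ≤ P.gain * s.relGain c * (2 * n * P.gain) := by positivity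
    push_cast
    linarith [h.le_softMin]

theorem Inv.sampleNext [NeZero n] (hS : IsSetting P β Ψ X f) (h : Inv P β Ψ X μ₀ s R N J)
    (hμ : 0 < s.guess) (c : Fin n) :
    ∃ J', Inv P β Ψ X μ₀ (s.sampleNext P f (orthantGrad Ψ) c) R (N + 1) J' := by
  by_cases hacc : s.relCost (s.prices (orthantGrad Ψ)) c (f c (s.prices (orthantGrad Ψ))) ≤ 4 * P.τ
  · exact ⟨J, h.step_of_le hS hμ c hacc⟩
  · exact ⟨J + 1, h.step_of_lt hS c (not_le.1 hacc)⟩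

theorem probe_eq_raise {y : Fin d → ℝ≥0} {B : Fin n → Fin d → ℝ}
    (h : P.τ * s.guess < ∑ c, cost (B c) y) : s.probe P y B = s.raise P := if_pos h

/-- There is at least one customer, so a minimizer exists and the last branch of `probe` is never
taken. -/
theorem exists_probe_eq_step [NeZero n] {y : Fin d → ℝ≥0} {B : Fin n → Fin d → ℝ}
    (h : ¬P.τ * s.guess < ∑ c, cost (B c) y) :
    ∃ c, s.probe P y B = s.step P y c (B c) ∧
      ∀ c', (s.step P y c (B c)).potential P ≤ (s.step P y c' (B c')).potential P := by
  have hex : ∃ c, ∀ c', (s.step P y c (B c)).potential P ≤ (s.step P y c' (B c')).potential P :=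
    Finite.exists_min _
  refine ⟨hex.choose, ?_, hex.choose_spec⟩
  rw [probe, if_neg h, dif_pos hex]

end Preservation

end State

/-- The invariants after `k` iterations. -/
def LoopInv {n d : ℕ} (P : Params) (β : Fin d → ℝ) (Ψ : (Fin d → ℝ) → ℝ)
    (X : Fin n → Set (Fin d → ℝ)) (μ₀ : ℝ) (k : ℕ) (s : State n d) : Prop :=
  ∃ R N J, R + N = k ∧ State.Inv P β Ψ X μ₀ s R N J

section LoopInv

variable {n d : ℕ} {P : Params} {β : Fin d → ℝ} {Ψ : (Fin d → ℝ) → ℝ} {X : Fin n → Set (Fin d → ℝ)}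
  {f : Fin n → (Fin d → ℝ≥0) → (Fin d → ℝ)} {μ₀ : ℝ} {k : ℕ} {s : State n d}

theorem LoopInv.guess_pos (hS : IsSetting P β Ψ X f) (hμ₀ : 0 < μ₀)
    (h : LoopInv P β Ψ X μ₀ k s) : 0 < s.guess := by
  obtain ⟨R, N, J, -, h⟩ := h
  rw [h.guess_eq]
  have := hS.incr_pos
  positivity

theorem LoopInv.sampleNext [NeZero n] (hS : IsSetting P β Ψ X f) (hμ₀ : 0 < μ₀)
    (h : LoopInv P β Ψ X μ₀ k s) (c : Fin n) :
    LoopInv P β Ψ X μ₀ (k + 1) (s.sampleNext P f (orthantGrad Ψ) c) := by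
  have hμ := h.guess_pos hS hμ₀
  obtain ⟨R, N, J, rfl, h⟩ := h
  obtain ⟨J', h'⟩ := h.sampleNext hS hμ c
  exact ⟨R, N + 1, J', (add_assoc _ _ _).symm, h'⟩

theorem LoopInv.probeNext [NeZero n] (hS : IsSetting P β Ψ X f) (hμ₀ : 0 < μ₀)
    (h : LoopInv P β Ψ X μ₀ k s) :
    LoopInv P β Ψ X μ₀ (k + 1) (s.probeNext P f (orthantGrad Ψ)) := by
  have hμ := h.guess_pos hS hμ₀
  by_cases hlt : P.τ * s.guess <
      ∑ c, cost (f c (s.prices (orthantGrad Ψ))) (s.prices (orthantGrad Ψ))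
  · obtain ⟨R, N, J, rfl, h⟩ := h
    refine ⟨R + 1, N, J, by ring, ?_⟩
    rw [State.probeNext, State.probe_eq_raise hlt]
    exact h.raise hS hlt hμ
  · obtain ⟨c, hc, -⟩ := State.exists_probe_eq_step hlt
    rw [State.probeNext, hc]
    exact h.sampleNext hS hμ₀ c

end LoopInv

/-! ### Growth of the exponential potential. -/

theorem exp_le_one_add_add_sq {x : ℝ} (hx : |x| ≤ 1) : Real.exp x ≤ 1 + x + x ^ 2 := by
  have := (abs_le.1 (Real.abs_exp_sub_one_sub_id_le hx)).2
  linarith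

/-- A bound on the moment generating function of a bounded random variable. -/
theorem sum_mul_exp_le {ι : Type*} [Fintype ι] {q Y : ι → ℝ} {D t : ℝ} (hq : ∀ i, 0 ≤ q i)
    (hq1 : ∑ i, q i = 1) (hY : ∀ i, |Y i| ≤ D) (hmean : ∑ i, q i * Y i ≤ 0) (ht : 0 ≤ t)
    (htD : t * D ≤ 1) : ∑ i, q i * Real.exp (t * Y i) ≤ Real.exp ((t * D) ^ 2) := by
  have h1 : ∀ i, q i * Real.exp (t * Y i) ≤ q i * (1 + (t * D) ^ 2) + t * (q i * Y i) := by
    intro i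
    have h2 : |t * Y i| ≤ t * D := by
      rw [abs_mul, abs_of_nonneg ht]
      exact mul_le_mul_of_nonneg_left (hY i) ht
    have h3 := exp_le_one_add_add_sq (h2.trans htD)
    have h4 : (t * Y i) ^ 2 ≤ (t * D) ^ 2 := sq_le_sq' (abs_le.1 h2).1 (abs_le.1 h2).2
    calc q i * Real.exp (t * Y i) ≤ q i * (1 + t * Y i + (t * D) ^ 2) :=
          mul_le_mul_of_nonneg_left (by linarith) (hq i)
      _ = _ := by ring
  calc ∑ i, q i * Real.exp (t * Y i) ≤ ∑ i, (q i * (1 + (t * D) ^ 2) + t * (q i * Y i)) :=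
        Finset.sum_le_sum fun i _ => h1 i
    _ = 1 + (t * D) ^ 2 + t * ∑ i, q i * Y i := by
        rw [Finset.sum_add_distrib, ← Finset.sum_mul, ← Finset.mul_sum, hq1, one_mul]
    _ ≤ (t * D) ^ 2 + 1 := by linarith [mul_nonpos_of_nonneg_of_nonpos ht hmean]
    _ ≤ _ := Real.add_one_le_exp _

namespace State

variable {n d : ℕ} {P : Params} {β : Fin d → ℝ} {Ψ : (Fin d → ℝ) → ℝ} {X : Fin n → Set (Fin d → ℝ)}
  {f : Fin n → (Fin d → ℝ≥0) → (Fin d → ℝ)} {s : State n d}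

theorem potential_pos (s : State n d) : 0 < s.potential P :=
  add_pos (Real.exp_pos _) (Real.exp_pos _)

theorem guess_pos_sampleNext (hμ : 0 < s.guess) (g : (Fin d → ℝ) → (Fin d → ℝ)) (c : Fin n) :
    0 < (s.sampleNext P f g c).guess := hμ

theorem guess_pos_probeNext [NeZero n] (hP : 0 < P.incr) (hμ : 0 < s.guess)
    (g : (Fin d → ℝ) → (Fin d → ℝ)) : 0 < (s.probeNext P f g).guess := by
  by_cases hlt : P.τ * s.guess < ∑ c, cost (f c (s.prices g)) (s.prices g)
  · rw [State.probeNext, State.probe_eq_raise hlt]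
    exact mul_pos hμ (by linarith)
  · obtain ⟨c, hc, -⟩ := State.exists_probe_eq_step (P := P) (s := s) (y := s.prices g)
      (B := fun c => f c (s.prices g)) hlt
    rw [State.probeNext, hc]
    exact hμ

theorem sum_prob_mul_potential (g : (Fin d → ℝ) → (Fin d → ℝ)) :
    ∑ c, s.prob c * (s.sampleNext P f g c).potential P =
      ∑ c, s.prob c * Real.exp (P.scale * (s.costErr +
        (min (s.relCost (s.prices g) c (f c (s.prices g))) (4 * P.τ) - P.τ))) +
      ∑ c, s.prob c * Real.exp (P.scale * (s.gainErr + (1 - s.relGain c))) := by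
  rw [← Finset.sum_add_distrib]
  exact Finset.sum_congr rfl fun c _ => mul_add _ _ _

section Mean

variable [NeZero n]

theorem relCost_nonneg (hS : IsSetting P β Ψ X f) (hμ : 0 < s.guess) (c : Fin n) (y : Fin d → ℝ≥0) :
    0 ≤ s.relCost y c (f c y) :=
  div_nonneg (cost_nonneg hS c y) (mul_pos hμ (s.prob_pos c)).le

theorem sum_prob_mul_exp_gainErr_le (hτ : 1 ≤ P.τ) (hscale : 0 < P.scale)
    (h1 : P.scale * (3 * P.τ) ≤ 1) :
    ∑ c, s.prob c * Real.exp (P.scale * (s.gainErr + (1 - s.relGain c))) ≤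
      Real.exp ((P.scale * (3 * P.τ)) ^ 2) * Real.exp (P.scale * s.gainErr) := by
  have h := sum_mul_exp_le (q := s.prob) (Y := fun c => 1 - s.relGain c) (D := 3 * P.τ)
    (fun c => (s.prob_pos c).le) s.sum_prob
    (fun c => by
      have := s.relGain_nonneg c
      have := s.relGain_le_two c
      rw [abs_le]
      constructor <;> linarith)
    (by simp only [mul_sub, mul_one, Finset.sum_sub_distrib, s.sum_prob,
          s.sum_prob_mul_relGain]; norm_num) hscale.le h1
  refine le_trans (le_of_eq ?_) (mul_le_mul_of_nonneg_right h (Real.exp_pos _).le)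
  rw [Finset.sum_mul]
  refine Finset.sum_congr rfl fun c _ => ?_
  rw [mul_assoc, ← Real.exp_add]
  ring_nf

theorem sum_prob_mul_relCost (hμ : 0 < s.guess) (y : Fin d → ℝ≥0) :
    ∑ c, s.prob c * s.relCost y c (f c y) = (∑ c, cost (f c y) y) / s.guess := by
  rw [Finset.sum_div]
  refine Finset.sum_congr rfl fun c _ => ?_
  have := (s.prob_pos c).ne'
  rw [relCost]
  field_simp

theorem abs_costErr_le (hS : IsSetting P β Ψ X f) (hμ : 0 < s.guess) (c : Fin n)
    (y : Fin d → ℝ≥0) : |min (s.relCost y c (f c y)) (4 * P.τ) - P.τ| ≤ 3 * P.τ := by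
  have h1 := hS.one_le_τ
  have h2 : 0 ≤ min (s.relCost y c (f c y)) (4 * P.τ) :=
    le_min (relCost_nonneg hS hμ c y) (by linarith)
  have h3 := min_le_right (s.relCost y c (f c y)) (4 * P.τ)
  rw [abs_le]
  constructor <;> linarith

theorem sum_prob_mul_exp_costErr_le (hS : IsSetting P β Ψ X f) (hμ : 0 < s.guess)
    (hscale : 0 < P.scale) (h1 : P.scale * (3 * P.τ) ≤ 1) (y : Fin d → ℝ≥0)
    (hle : ∑ c, cost (f c y) y ≤ P.τ * s.guess) :
    ∑ c, s.prob c * Real.exp (P.scale * (s.costErr +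
      (min (s.relCost y c (f c y)) (4 * P.τ) - P.τ))) ≤
      Real.exp ((P.scale * (3 * P.τ)) ^ 2) * Real.exp (P.scale * s.costErr) := by
  have h := sum_mul_exp_le (q := s.prob)
    (Y := fun c => min (s.relCost y c (f c y)) (4 * P.τ) - P.τ) (D := 3 * P.τ)
    (fun c => (s.prob_pos c).le) s.sum_prob (fun c => abs_costErr_le hS hμ c y)
    (by
      have h2 : ∑ c, s.prob c * min (s.relCost y c (f c y)) (4 * P.τ) ≤
          ∑ c, s.prob c * s.relCost y c (f c y) :=
        Finset.sum_le_sum fun c _ =>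
          mul_le_mul_of_nonneg_left (min_le_left _ _) (s.prob_pos c).le
      rw [sum_prob_mul_relCost hμ] at h2
      have h3 : (∑ c, cost (f c y) y) / s.guess ≤ P.τ := (div_le_iff₀ hμ).2 hle
      simp only [mul_sub, Finset.sum_sub_distrib]
      rw [← Finset.sum_mul, s.sum_prob]
      linarith) hscale.le h1
  refine le_trans (le_of_eq ?_) (mul_le_mul_of_nonneg_right h (Real.exp_pos _).le)
  rw [Finset.sum_mul]
  refine Finset.sum_congr rfl fun c _ => ?_
  rw [mul_assoc, ← Real.exp_add]
  ring_nf

theorem sum_prob_mul_potential_le (hS : IsSetting P β Ψ X f) (hμ : 0 < s.guess)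
    (hscale : 0 < P.scale) (h1 : P.scale * (3 * P.τ) ≤ 1) (g : (Fin d → ℝ) → (Fin d → ℝ))
    (hle : ∑ c, cost (f c (s.prices g)) (s.prices g) ≤ P.τ * s.guess) :
    ∑ c, s.prob c * (s.sampleNext P f g c).potential P ≤
      Real.exp ((P.scale * (3 * P.τ)) ^ 2) * s.potential P := by
  rw [sum_prob_mul_potential, potential, mul_add]
  exact add_le_add (sum_prob_mul_exp_costErr_le hS hμ hscale h1 _ hle)
    (sum_prob_mul_exp_gainErr_le hS.one_le_τ hscale h1)

/-- Method of conditional expectations: the best customer does no worse than the average over the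
sampling distribution. A raise only lowers the potential. -/
theorem potential_probeNext_le (hS : IsSetting P β Ψ X f) (hμ : 0 < s.guess)
    (hscale : 0 < P.scale) (h1 : P.scale * (3 * P.τ) ≤ 1) (g : (Fin d → ℝ) → (Fin d → ℝ)) :
    (s.probeNext P f g).potential P ≤ Real.exp ((P.scale * (3 * P.τ)) ^ 2) * s.potential P := by
  by_cases hlt : P.τ * s.guess < ∑ c, cost (f c (s.prices g)) (s.prices g)
  · have h2 : (1 : ℝ) ≤ Real.exp ((P.scale * (3 * P.τ)) ^ 2) := Real.one_le_exp (sq_nonneg _)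
    refine le_trans ?_ (le_mul_of_one_le_left s.potential_pos.le h2)
    rw [State.probeNext, State.probe_eq_raise hlt]
    have h3 : 0 ≤ 12 * P.τ * (n : ℝ) := by
      have := hS.one_le_τ
      positivity
    refine add_le_add (Real.exp_le_exp.2 (mul_le_mul_of_nonneg_left ?_ hscale.le)) le_rfl
    simp only [State.raise]
    linarith
  · obtain ⟨c, hc, hmin⟩ := State.exists_probe_eq_step (P := P) (s := s) (y := s.prices g)
      (B := fun c => f c (s.prices g)) hlt
    refine le_trans ?_ (sum_prob_mul_potential_le hS hμ hscale h1 g (not_lt.1 hlt))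
    rw [State.probeNext, hc, ← one_mul (potential P _), ← s.sum_prob, Finset.sum_mul]
    exact Finset.sum_le_sum fun c' _ => mul_le_mul_of_nonneg_left (hmin c') (s.prob_pos c').le

/-- The potential increases by a small factor per iteration in expectation, whether or not the
guess is too small. -/
theorem mean_potential_le (hS : IsSetting P β Ψ X f) (hμ : 0 < s.guess)
    (hscale : 0 < P.scale) (h1 : P.scale * (3 * P.τ) ≤ 1) (h2 : 24 * P.τ * n * P.scale ≤ 1)
    (g : (Fin d → ℝ) → (Fin d → ℝ)) :
    (s.probeNext P f g).potential P + n * ∑ c, s.prob c * (s.sampleNext P f g c).potential P ≤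
      (n + 1) * (Real.exp ((P.scale * (3 * P.τ)) ^ 2) * s.potential P) := by
  have hn : (0 : ℝ) < n := Nat.cast_pos.mpr (NeZero.pos n)
  by_cases hlt : P.τ * s.guess < ∑ c, cost (f c (s.prices g)) (s.prices g)
  · set E := Real.exp ((P.scale * (3 * P.τ)) ^ 2) with hE
    have hE1 : 1 ≤ E := Real.one_le_exp (sq_nonneg _)
    have hgain := sum_prob_mul_exp_gainErr_le (s := s) hS.one_le_τ hscale h1
    have hτ := hS.one_le_τ
    -- The guess is too small, so the mean of the cost deviation is not controlled; only its maximum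
    -- 3τ is available.
    have hcost : ∑ c, s.prob c * Real.exp (P.scale * (s.costErr +
        (min (s.relCost (s.prices g) c (f c (s.prices g))) (4 * P.τ) - P.τ))) ≤
        (1 + 2 * (P.scale * (3 * P.τ))) * Real.exp (P.scale * s.costErr) := by
      have hsum : ∑ c, s.prob c * ((1 + 2 * (P.scale * (3 * P.τ))) *
          Real.exp (P.scale * s.costErr)) =
          (1 + 2 * (P.scale * (3 * P.τ))) * Real.exp (P.scale * s.costErr) := by
        rw [← Finset.sum_mul, s.sum_prob, one_mul]
      rw [← hsum]
      refine Finset.sum_le_sum fun c _ => mul_le_mul_of_nonneg_left ?_ (s.prob_pos c).le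
      rw [mul_add, Real.exp_add, mul_comm]
      refine mul_le_mul_of_nonneg_right ?_ (Real.exp_pos _).le
      have h3 := mul_le_mul_of_nonneg_left
        (abs_le.1 (abs_costErr_le hS hμ c (s.prices g))).2 hscale.le
      have h0 : 0 ≤ P.scale * (3 * P.τ) := by positivity
      have h4 := exp_le_one_add_add_sq (x := P.scale * (3 * P.τ)) (by rwa [abs_of_nonneg h0])
      refine (Real.exp_le_exp.2 h3).trans (h4.trans ?_)
      nlinarith
    have hprobe : (s.probeNext P f g).potential P ≤
        (1 - 6 * P.τ * n * P.scale) * Real.exp (P.scale * s.costErr) +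
          Real.exp (P.scale * s.gainErr) := by
      rw [State.probeNext, State.probe_eq_raise hlt]
      refine add_le_add ?_ le_rfl
      simp only [State.raise]
      rw [mul_sub, sub_eq_add_neg, Real.exp_add, mul_comm]
      refine mul_le_mul_of_nonneg_right ?_ (Real.exp_pos _).le
      set x := P.scale * (12 * P.τ * n) with hx
      have h0 : 0 ≤ x := by positivity
      have hx1 : x ≤ 1 / 2 := by linarith
      have h4 := exp_le_one_add_add_sq (x := -x) (by rw [abs_neg, abs_of_nonneg h0]; linarith)
      have : 6 * P.τ * n * P.scale = x / 2 := by rw [hx]; ring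
      rw [this]
      nlinarith
    -- The terms of first order cancel: (1 - 6τn·scale) + n(1 + 6τ·scale) = n + 1. This is why a
    -- raise subtracts a multiple of τn from `costErr`.
    rw [sum_prob_mul_potential]
    have e1 := mul_le_mul_of_nonneg_left hcost hn.le
    have e2 := mul_le_mul_of_nonneg_left hgain hn.le
    have p1 := Real.exp_pos (P.scale * s.costErr)
    have p2 := Real.exp_pos (P.scale * s.gainErr)
    have e3 : ((n : ℝ) + 1) * Real.exp (P.scale * s.costErr) ≤
        (n + 1) * (E * Real.exp (P.scale * s.costErr)) :=
      mul_le_mul_of_nonneg_left (le_mul_of_one_le_left p1.le hE1) (by positivity)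
    have e4 := le_mul_of_one_le_left p2.le hE1
    have e5 : s.potential P =
      Real.exp (P.scale * s.costErr) + Real.exp (P.scale * s.gainErr) := rfl
    rw [e5]
    linarith
  · have e1 := mul_le_mul_of_nonneg_left
      (sum_prob_mul_potential_le hS hμ hscale h1 g (not_lt.1 hlt)) hn.le
    have e2 := potential_probeNext_le hS hμ hscale h1 g
    linarith

theorem potential_iterate_probeNext_le (hS : IsSetting P β Ψ X f)
    (hscale : 0 < P.scale) (h1 : P.scale * (3 * P.τ) ≤ 1) (g : (Fin d → ℝ) → (Fin d → ℝ))
    (N : ℕ) (s : State n d) (hμ : 0 < s.guess) :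
    ((State.probeNext P f g)^[N] s).potential P ≤
      Real.exp ((P.scale * (3 * P.τ)) ^ 2) ^ N * s.potential P := by
  induction N generalizing s with
  | zero => simp
  | succ N ih =>
    rw [Function.iterate_succ_apply, pow_succ, mul_assoc]
    exact (ih _ (guess_pos_probeNext hS.incr_pos hμ g)).trans
      (mul_le_mul_of_nonneg_left (potential_probeNext_le hS hμ hscale h1 g) (by positivity))

end Mean

end State

/-! ### Tail bound for the number of oracle calls. -/

section Tail

variable {n d : ℕ} [NeZero n] {P : Params} {β : Fin d → ℝ} {Ψ : (Fin d → ℝ) → ℝ}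
  {X : Fin n → Set (Fin d → ℝ)} {f : Fin n → (Fin d → ℝ≥0) → (Fin d → ℝ)}

/-- The number of oracle calls of the random loop exceeds its expectation substantially, or the
loop ends in a bad state, only with a small probability. -/
theorem prob_randLoop_le (hS : IsSetting P β Ψ X f)
    (hscale : 0 < P.scale) (h1 : P.scale * (3 * P.τ) ≤ 1) (h2 : 24 * P.τ * n * P.scale ≤ 1)
    (g : (Fin d → ℝ) → (Fin d → ℝ)) {next : State n d → Algorithm n d} {good : State n d → Prop}
    (hgood : ∀ s, good s → ∃ x, next s = .output x) {δ : ℝ} (hδ : 0 ≤ δ)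
    (hbad : ∀ s, ¬good s → 1 ≤ δ * s.potential P) (A : ℕ) (m : ℝ)
    (N : ℕ) (s : State n d) (hμ : 0 < s.guess) (a p : ℕ) (ha : a + N ≤ A + n * p) :
    (randLoop P next N s).prob f g {r | (A : ℝ) + n * m < (r.oracleCalls + a : ℕ)} ≤
      ENNReal.ofReal (δ * (Real.exp ((P.scale * (3 * P.τ)) ^ 2) ^ N * s.potential P) +
        Real.exp (2 / (n + 1)) ^ N * Real.exp (p - m)) := by
  have hn : (0 : ℝ) < n := Nat.cast_pos.mpr (NeZero.pos n)
  -- So far `a` oracle calls and `p` full queries were made. The budget `ha` survives both kinds of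
  -- iteration, as each lowers `N` by one.
  induction N generalizing s a p with
  | zero =>
    have hpot := s.potential_pos (P := P)
    have hle_one : (randLoop P next 0 s).prob f g
        {r | (A : ℝ) + n * m < (r.oracleCalls + a : ℕ)} ≤ 1 := by
      rw [Algorithm.prob, PMF.toOuterMeasure_apply, ← PMF.tsum_coe ((randLoop P next 0 s).run f g)]
      exact ENNReal.tsum_le_tsum fun r => Set.indicator_le_self _ _ r
    rw [pow_zero, one_mul, pow_zero, one_mul]
    by_cases hg : good s
    -- With too many full queries the second summand is at least 1. Otherwise the budget rules out
    -- the event, since a good state leads to an output without further calls.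
    · by_cases hmp : m ≤ p
      · refine hle_one.trans (ENNReal.one_le_ofReal.2 ?_)
        have e1 : 1 ≤ Real.exp (p - m) := Real.one_le_exp (by linarith)
        have e2 := mul_nonneg hδ hpot.le
        linarith
      · obtain ⟨x, hx⟩ := hgood s hg
        refine le_of_eq_of_le ?_ zero_le
        rw [Algorithm.prob, randLoop, hx, Algorithm.run, PMF.toOuterMeasure_pure_apply, if_neg]
        simp only [Set.mem_ofPred_eq, not_lt]
        have e1 : ((0 + a : ℕ) : ℝ) ≤ A + n * p := by
          rw [zero_add]
          exact_mod_cast ha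
        exact e1.trans (add_le_add le_rfl (mul_le_mul_of_nonneg_left (not_le.1 hmp).le hn.le))
    · refine hle_one.trans (ENNReal.one_le_ofReal.2 ?_)
      have e1 := Real.exp_pos (p - m)
      have e2 := hbad s hg
      linarith
  | succ N ih =>
    set E := Real.exp ((P.scale * (3 * P.τ)) ^ 2) with hE
    set H := Real.exp (2 / ((n : ℝ) + 1)) with hH
    have ihp := ih _ (State.guess_pos_probeNext (f := f) hS.incr_pos hμ g) (a + n) (p + 1)
      (by rw [mul_add, mul_one]; omega)
    have ihs := fun c => ih _ (State.guess_pos_sampleNext (P := P) (f := f) hμ g c) (a + 1) p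
      (by omega)
    have hsetp : Outcome.shift n 1 ⁻¹' {r : Outcome d | (A : ℝ) + n * m < (r.oracleCalls + a : ℕ)} =
        {r | (A : ℝ) + n * m < (r.oracleCalls + (a + n) : ℕ)} := by
      ext r
      simp only [Outcome.shift, Set.mem_preimage, Set.mem_ofPred_eq, add_assoc, add_comm a]
    have hsets : Outcome.shift 1 1 ⁻¹' {r : Outcome d | (A : ℝ) + n * m < (r.oracleCalls + a : ℕ)} =
        {r | (A : ℝ) + n * m < (r.oracleCalls + (a + 1) : ℕ)} := by
      ext r
      simp only [Outcome.shift, Set.mem_preimage, Set.mem_ofPred_eq, add_assoc, add_comm a]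
    rw [prob_randLoop_succ, hsetp, hsets]
    set Fp := δ * (E ^ N * (s.probeNext P f g).potential P) + H ^ N * Real.exp ((p + 1 : ℕ) - m)
      with hFp
    set Fs := fun c => δ * (E ^ N * (s.sampleNext P f g c).potential P) + H ^ N * Real.exp (p - m)
      with hFs
    have hE0 : 0 ≤ E ^ N := by positivity
    have hH0 : 0 ≤ H ^ N := by positivity
    have hFs0 : ∀ c, 0 ≤ Fs c := fun c =>
      add_nonneg (mul_nonneg hδ (mul_nonneg hE0 (State.potential_pos _).le))
        (mul_nonneg hH0 (Real.exp_pos _).le)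
    have hFp0 : 0 ≤ Fp :=
      add_nonneg (mul_nonneg hδ (mul_nonneg hE0 (State.potential_pos _).le))
        (mul_nonneg hH0 (Real.exp_pos _).le)
    have hsum : ∑ c, ENNReal.ofReal (s.prob c) * (randLoop P next N (s.sampleNext P f g c)).prob f g
        {r | (A : ℝ) + n * m < (r.oracleCalls + (a + 1) : ℕ)} ≤
        ENNReal.ofReal (∑ c, s.prob c * Fs c) := by
      rw [ENNReal.ofReal_sum_of_nonneg fun c _ => mul_nonneg (s.prob_pos c).le (hFs0 c)]
      refine Finset.sum_le_sum fun c _ => ?_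
      rw [ENNReal.ofReal_mul (s.prob_pos c).le]
      exact mul_le_mul_right (ihs c) _
    have hS0 : 0 ≤ ∑ c, s.prob c * Fs c :=
      Finset.sum_nonneg fun c _ => mul_nonneg (s.prob_pos c).le (hFs0 c)
    have hconv : (n + 1 : ℝ≥0∞)⁻¹ * (ENNReal.ofReal Fp +
        n * ENNReal.ofReal (∑ c, s.prob c * Fs c)) =
        ENNReal.ofReal (((n : ℝ) + 1)⁻¹ * (Fp + n * ∑ c, s.prob c * Fs c)) := by
      rw [ENNReal.ofReal_mul (by positivity), ENNReal.ofReal_add hFp0 (mul_nonneg hn.le hS0),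
        ENNReal.ofReal_mul hn.le, ENNReal.ofReal_natCast, ENNReal.ofReal_inv_of_pos (by positivity),
        ENNReal.ofReal_add hn.le zero_le_one, ENNReal.ofReal_natCast, ENNReal.ofReal_one]
    refine le_trans (mul_le_mul_right (add_le_add ihp (mul_le_mul_right hsum _)) _) ?_
    rw [hconv]
    refine ENNReal.ofReal_le_ofReal ?_
    rw [inv_mul_le_iff₀ (by positivity)]
    have hmean := State.mean_potential_le hS hμ hscale h1 h2 g
    have hmean' := mul_le_mul_of_nonneg_left (mul_le_mul_of_nonneg_left hmean hE0) hδ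
    have hsumF : ∑ c, s.prob c * Fs c =
        δ * (E ^ N * ∑ c, s.prob c * (s.sampleNext P f g c).potential P) +
          H ^ N * Real.exp (p - m) := by
      simp only [hFs, mul_add, Finset.sum_add_distrib]
      rw [← Finset.sum_mul, s.sum_prob, one_mul]
      congr 1
      rw [Finset.mul_sum, Finset.mul_sum]
      exact Finset.sum_congr rfl fun c _ => by ring
    have hexp : Real.exp ((p + 1 : ℕ) - m) ≤ 3 * Real.exp (p - m) := by
      push_cast
      rw [add_sub_right_comm, Real.exp_add, mul_comm]
      exact mul_le_mul_of_nonneg_right (Real.exp_one_lt_d9.le.trans (by norm_num))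
        (Real.exp_pos _).le
    -- A full query multiplies exp(p) by e ≤ 3, a sample leaves it unchanged; the average factor is
    -- at most (n+3)/(n+1) = 1 + 2/(n+1) ≤ H.
    have hHge : (n : ℝ) + 3 ≤ (n + 1) * H := by
      have e1 := Real.add_one_le_exp (2 / ((n : ℝ) + 1))
      have e2 := mul_le_mul_of_nonneg_left e1 (by positivity : (0 : ℝ) ≤ n + 1)
      refine le_trans (le_of_eq ?_) e2
      field_simp
      ring
    have hK : 0 ≤ H ^ N * Real.exp (p - m) := mul_nonneg hH0 (Real.exp_pos _).le
    have e3 := mul_le_mul_of_nonneg_left hexp hH0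
    have e4 := mul_le_mul_of_nonneg_right hHge hK
    rw [hsumF, hFp, pow_succ, pow_succ]
    linarith

end Tail

/-! ### From a good state to an approximate solution. -/

section Finish

variable {n d : ℕ} {P : Params} {β : Fin d → ℝ} {Ψ : (Fin d → ℝ) → ℝ} {X : Fin n → Set (Fin d → ℝ)}
  {f : Fin n → (Fin d → ℝ≥0) → (Fin d → ℝ)} {μ₀ : ℝ} {s : State n d} {R N : ℕ} {J : ℝ}

/-- The solution obtained from a state by averaging the oracle answers of each customer. -/
def State.solution (s : State n d) : Fin d → ℝ := ∑ c, (s.progress c)⁻¹ • s.alloc c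

/-- The deviations are small compared to the progress. -/
def State.IsGood (P : Params) (s : State n d) : Prop :=
  P.gain * s.costErr ≤ Real.log (n + d) ∧ P.gain * s.gainErr ≤ Real.log (n + d)

theorem half_le_log [NeZero n] (hd : 1 ≤ d) : 1 / 2 ≤ Real.log ((n : ℝ) + d) := by
  have h1 : (1 : ℝ) ≤ n := by exact_mod_cast NeZero.one_le (n := n)
  have h2 : (1 : ℝ) ≤ d := by exact_mod_cast hd
  have h3 : Real.log 2 ≤ Real.log ((n : ℝ) + d) := Real.log_le_log two_pos (by linarith)
  linarith [Real.log_two_gt_d9]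

/-- Given sufficient progress, the potentials are related as required. -/
theorem potential_ratio {ψ Q T j a b L τ ε : ℝ} (hτ : 1 ≤ τ) (hε : 0 < ε) (hε1 : ε ≤ 1)
    (ha : 0 ≤ a) (hb : 0 ≤ b) (hab : 48 * τ * (a + b) ≤ ε) (hL : 0 < L) (hj : 0 ≤ j) (hψ : 0 ≤ ψ)
    (hT : 28 * L ≤ T * ε) (h1 : ψ + 4 * τ * j ≤ τ * T + 3 * L)
    (h2 : T - 2 * a * T - 2 * L ≤ Q + 2 * b * ψ + 2 * j) :
    0 < Q ∧ ψ ≤ (1 + ε / 3) * τ * Q := by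
  have hT0 : 0 < T := by
    by_contra! h
    have := mul_nonpos_of_nonpos_of_nonneg h hε.le
    linarith
  have haε : 48 * a ≤ ε := by nlinarith
  have hbε : 48 * (τ * b) ≤ ε := by nlinarith
  have hTL : 28 * L ≤ T := by nlinarith
  have hbψ : 2 * b * ψ ≤ 2 * b * (τ * T + 3 * L) :=
    mul_le_mul_of_nonneg_left (by nlinarith) (by positivity)
  constructor
  · have e1 : 48 * (a * T) ≤ T := by nlinarith
    have e2 : 48 * (τ * b * T) ≤ T := by nlinarith
    have e3 : b ≤ τ * b := le_mul_of_one_le_left hb hτ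
    have e4 : b * L ≤ L := by nlinarith
    have e5 : 4 * j ≤ T + 3 * L := by nlinarith
    nlinarith
  · have e1 : (1 + ε / 3) * τ * (T - 2 * a * T - 2 * L - 2 * b * ψ - 2 * j) ≤
        (1 + ε / 3) * τ * Q := mul_le_mul_of_nonneg_left (by linarith) (by positivity)
    refine le_trans ?_ e1
    have hbψ0 : 0 ≤ b * ψ := mul_nonneg hb hψ
    have hτ0 := zero_le_one.trans hτ
    -- With 1 + ε/3 ≤ 4/3, the rejections cost at most (8/3)τj on the right but save 4τj on the
    -- left. The slack ετT/3 absorbs the remaining error terms.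
    have aux : ∀ x, 0 ≤ x → (1 + ε / 3) * x ≤ 4 / 3 * x := fun x hx =>
      mul_le_mul_of_nonneg_right (by linarith) hx
    have e2 := aux _ (mul_nonneg hτ0 hbψ0)
    have e3 := aux _ (mul_nonneg hτ0 hj)
    have e4 := aux _ (mul_nonneg hτ0 hL.le)
    have e5 := aux _ (mul_nonneg hτ0 (mul_nonneg ha hT0.le))
    have f2 := mul_nonneg hτ0 hbψ0
    have f3 := mul_nonneg hτ0 hj
    have f4 := mul_nonneg hτ0 hL.le
    have f5 := mul_nonneg hτ0 (mul_nonneg ha hT0.le)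
    have e6 : 4 * τ * (b * ψ) ≤ 4 * τ * (b * (τ * T + 3 * L)) := by
      have := mul_le_mul_of_nonneg_left hbψ (zero_le_one.trans hτ)
      linarith
    have e7 := mul_le_mul_of_nonneg_right (hbε.trans hε1) hL.le
    have e8 : 4 * τ * (a * T) + 4 * τ * (b * (τ * T)) ≤ τ * T * (ε / 12) := by
      have h3 : a ≤ τ * a := le_mul_of_one_le_left ha hτ
      have h4 := mul_le_mul_of_nonneg_left (show 4 * a + 4 * (τ * b) ≤ ε / 12 by linarith)
        (mul_nonneg (zero_le_one.trans hτ) hT0.le)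
      linarith
    have e9 : L ≤ τ * L := le_mul_of_one_le_left hL.le hτ
    have e10 := mul_le_mul_of_nonneg_left hT (zero_le_one.trans hτ)
    linarith

/-- A good state with sufficient progress yields an approximately optimum solution. -/
theorem State.Inv.solution_spec [NeZero n] (hS : IsSetting P β Ψ X f)
    (h : State.Inv P β Ψ X μ₀ s R N J) (hμ : 0 < s.guess) (hgood : s.IsGood P) {ε : ℝ} (hε : 0 < ε) (hε1 : ε ≤ 1)
    (hincr : P.incr = ε / 3) (hgain : 48 * P.τ * (P.gain * (n + d)) ≤ ε)
    (hR : P.gain * (12 * P.τ * n * R) ≤ Real.log (n + d))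
    (hN : 28 * Real.log (n + d) ≤ P.gain * N * ε) :
    s.solution ∈ feasible X ∧
      orderedNorm β s.solution ≤ (1 + ε) * P.τ * optValue β X := by
  have hd := hS.weight.dim_pos
  have hg := hS.gain_pos
  have hτ := hS.one_le_τ
  set L := Real.log ((n : ℝ) + d) with hL
  have hL0 : 0 < L := lt_of_lt_of_le (by norm_num) (half_le_log (n := n) hd)
  have hn1 : (1 : ℝ) ≤ n := by exact_mod_cast NeZero.one_le (n := n)
  have hd1 : (1 : ℝ) ≤ d := by exact_mod_cast hd
  have hlogd : Real.log d ≤ L := Real.log_le_log (by linarith) (by linarith)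
  have hlogn : Real.log n ≤ L := Real.log_le_log (by linarith) (by linarith)
  set ψ := Ψ s.loadVec with hψ
  have hψ0 : 0 ≤ ψ := hS.approx.nonneg hS.weight s.loadVec_mem
  have hnorm : orderedNorm β s.loadVec ≤ ψ := hS.approx.norm_le _ s.loadVec_mem
  have hsum : ∑ i, s.loadVec i ≤ d * ψ :=
    (sum_le_card_mul_orderedNorm hS.weight _).trans
      (mul_le_mul_of_nonneg_left hnorm (by positivity))
  obtain ⟨hA1, hA2⟩ := hgood
  have hratio := potential_ratio (ψ := ψ) (Q := s.softMin) (T := P.gain * N) (j := P.gain * J)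
    (a := P.gain * n) (b := P.gain * d) (L := L) hτ hε hε1 (by positivity) (by positivity)
    (by rw [← mul_add]; exact hgain) hL0 (mul_nonneg hg.le h.rejected_nonneg) hψ0 hN
    (by linarith [h.approx_le]) (by
      have h1 := h.le_softMin
      have h2 := mul_le_mul_of_nonneg_left hsum hg.le
      have hng : 2 * (P.gain * n) ≤ 1 := by
        have e1 : P.gain * n ≤ P.gain * (n + d) := mul_le_mul_of_nonneg_left (by linarith) hg.le
        have e2 : 0 ≤ P.gain * (n + d) := by positivity
        nlinarith
      have h3 : (1 - 2 * (P.gain * n)) * (P.gain * s.gainErr) ≤ L := by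
        have e1 := mul_le_mul_of_nonneg_left hA2 (sub_nonneg.2 hng)
        have e2 : 0 ≤ P.gain * n * L := by positivity
        linarith
      linarith)
  obtain ⟨hQ, hψQ⟩ := hratio
  -- The soft minimum is positive and below every progress, so every customer has made a step.
  have hmem : ∀ c, (s.progress c)⁻¹ • s.alloc c ∈ X c := by
    intro c
    rcases h.alloc_mem c with h1 | h1
    · have := s.softMin_le c
      rw [h1.1] at this
      linarith
    · exact h1.2
  have hfeas : s.solution ∈ feasible X := ⟨_, hmem, rfl⟩
  refine ⟨hfeas, ?_⟩
  have hopt : 0 ≤ optValue β X := optValue_nonneg hS.weight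
  -- Dividing by the own progress of each customer gives no more than dividing by the soft minimum.
  have hle : ∀ i, s.solution i ≤ ((s.guess / s.softMin) • s.loadVec) i := by
    intro i
    have h1 : s.solution i ≤ ∑ c, s.softMin⁻¹ * s.alloc c i := by
      rw [State.solution, Finset.sum_apply]
      refine Finset.sum_le_sum fun c _ => ?_
      have h2 := hQ.trans_le (s.softMin_le c)
      have h3 : 0 ≤ (s.progress c)⁻¹ * s.alloc c i := hS.inst.subset_orthant c (hmem c) i
      exact mul_le_mul_of_nonneg_right (inv_anti₀ hQ (s.softMin_le c))
        ((mul_nonneg_iff_of_pos_left (inv_pos.2 h2)).1 h3)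
    rw [← Finset.mul_sum] at h1
    refine h1.trans ((mul_le_mul_of_nonneg_left (h.alloc_le i) (inv_pos.2 hQ).le).trans_eq ?_)
    simp only [Pi.smul_apply, smul_eq_mul]
    ring
  have h1 := orderedNorm_mono hS.weight (feasible_subset_orthant hS.inst hfeas) hle
  have h2 := orderedNorm_smul_le hS.weight (div_nonneg hμ.le hQ.le) s.loadVec
  calc orderedNorm β s.solution ≤ s.guess / s.softMin * ψ :=
        h1.trans (h2.trans (mul_le_mul_of_nonneg_left hnorm (div_nonneg hμ.le hQ.le)))
    _ ≤ s.guess / s.softMin * ((1 + ε / 3) * P.τ * s.softMin) :=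
        mul_le_mul_of_nonneg_left hψQ (div_nonneg hμ.le hQ.le)
    _ = (1 + ε / 3) * P.τ * s.guess := by field_simp
    _ ≤ (1 + ε / 3) * P.τ * ((1 + ε / 3) * optValue β X) :=
        mul_le_mul_of_nonneg_left (hincr ▸ h.guess_le) (by positivity)
    _ = (1 + ε / 3) ^ 2 * (P.τ * optValue β X) := by ring
    _ ≤ (1 + ε) * (P.τ * optValue β X) :=
        mul_le_mul_of_nonneg_right (by nlinarith) (mul_nonneg (zero_le_one.trans hτ) hopt)
    _ = _ := by ring

end Finish

/-! ### The algorithm, its parameters and their arithmetic. -/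

section Main

/-- The relation between the progress per iteration and `ε / (n + d)`. -/
def gainConst (τ : ℝ) : ℝ := (10 ^ 7 * τ ^ 2)⁻¹

/-- The parameters used by the algorithm. -/
def algParams (τ : ℝ) (n d : ℕ) (ε : ℝ) : Params where
  τ := τ
  gain := gainConst τ * ε / (n + d)
  incr := ε / 3
  scale := 42 * (gainConst τ * ε / (n + d))

/-- The main part of the running time bound. -/
def mainRate (n d : ℕ) (ε : ℝ) : ℝ := ((n : ℝ) + d) * Real.log (n + d) * (ε ^ 2)⁻¹

/-- The number of iterations. -/
def numIter (τ : ℝ) (n d : ℕ) (ε : ℝ) : ℕ :=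
  ⌈300 * (mainRate n d ε / gainConst τ)⌉₊

/-- The initial state, where the guess is computed from the total load `a` of an approximate
solution for the all-ones prices. -/
def initState (τ : ℝ) (n d : ℕ) (a : ℝ) : State n d := ⟨a / (τ * d), 0, 0, 0, 0, 0⟩

variable {n d : ℕ}

/-- Output the solution of a state. -/
def outputSolution (s : State n d) : Algorithm n d := .output s.solution

open Classical in
/-- Output the solution of a good state; otherwise start again and query all customers in each
iteration. -/
def finish (τ ε a : ℝ) (s : State n d) : Algorithm n d :=
  if s.IsGood (algParams τ n d ε) then outputSolution s
  else detLoop (algParams τ n d ε) outputSolution (numIter τ n d ε) (initState τ n d a)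

/-- The algorithm for at least one customer. -/
def mainAlgorithm [NeZero n] (τ ε : ℝ) : Algorithm n d :=
  callAll 1 fun B =>
    if 0 < ∑ c, cost (B c) 1 then
      randLoop (algParams τ n d ε) (finish τ ε (∑ c, cost (B c) 1)) (numIter τ n d ε)
        (initState τ n d (∑ c, cost (B c) 1))
    else .output (∑ c, B c)

section Constants

variable {τ ε : ℝ}

theorem gainConst_pos (hτ : 1 ≤ τ) : 0 < gainConst τ := by
  unfold gainConst
  positivity

theorem sq_mul_gainConst (hτ : 1 ≤ τ) : τ ^ 2 * gainConst τ = (10 ^ 7)⁻¹ := by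
  unfold gainConst
  field_simp

theorem mul_gainConst_le (hτ : 1 ≤ τ) : τ * gainConst τ ≤ (10 ^ 7)⁻¹ := by
  rw [← sq_mul_gainConst hτ]
  exact mul_le_mul_of_nonneg_right (by nlinarith) (gainConst_pos hτ).le

theorem gainConst_le (hτ : 1 ≤ τ) : gainConst τ ≤ (10 ^ 7)⁻¹ :=
  (le_mul_of_one_le_left (gainConst_pos hτ).le hτ).trans (mul_gainConst_le hτ)

theorem exp_log_lt_potential_of_not_isGood (s : State n d)
    (h : ¬s.IsGood (algParams τ n d ε)) :
    Real.exp (42 * Real.log (n + d)) ≤ s.potential (algParams τ n d ε) := by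
  have hscale : (algParams τ n d ε).scale = 42 * (algParams τ n d ε).gain := rfl
  rw [State.IsGood, not_and_or, not_le, not_le] at h
  rw [State.potential, hscale]
  have p1 := Real.exp_pos (42 * (algParams τ n d ε).gain * s.costErr)
  have p2 := Real.exp_pos (42 * (algParams τ n d ε).gain * s.gainErr)
  rcases h with h | h
  · have := Real.exp_le_exp.2 (show 42 * Real.log ((n : ℝ) + d) ≤
      42 * (algParams τ n d ε).gain * s.costErr by linarith)
    linarith
  · have := Real.exp_le_exp.2 (show 42 * Real.log ((n : ℝ) + d) ≤
      42 * (algParams τ n d ε).gain * s.gainErr by linarith)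
    linarith

theorem potential_initState (τ ε a : ℝ) :
    (initState τ n d a).potential (algParams τ n d ε) = 2 := by
  simp only [State.potential, initState, mul_zero, Real.exp_zero]
  norm_num

variable [NeZero n]

theorem two_le_add (hd : 1 ≤ d) : (2 : ℝ) ≤ (n : ℝ) + d := by
  have h1 : (1 : ℝ) ≤ n := by exact_mod_cast NeZero.one_le (n := n)
  have h2 : (1 : ℝ) ≤ d := by exact_mod_cast hd
  linarith

theorem add_mul_log_le_mainRate (hd : 1 ≤ d) (hε : 0 < ε) (hε1 : ε ≤ 1) :
    ((n : ℝ) + d) * Real.log (n + d) ≤ mainRate n d ε := by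
  have h1 := half_le_log (n := n) hd
  have h2 := two_le_add (n := n) hd
  refine le_mul_of_one_le_right (mul_nonneg (by linarith) (by linarith)) ?_
  exact (one_le_inv₀ (by positivity)).2 (pow_le_one₀ hε.le hε1)

theorem one_le_mainRate (hd : 1 ≤ d) (hε : 0 < ε) (hε1 : ε ≤ 1) : 1 ≤ mainRate n d ε := by
  have h1 := half_le_log (n := n) hd
  have h2 := two_le_add (n := n) hd
  refine le_trans ?_ (add_mul_log_le_mainRate hd hε hε1)
  nlinarith

theorem mainRate_le_two_mul_rate (hd : 1 ≤ d) (hε : 0 < ε) (hε1 : ε ≤ 1) :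
    mainRate n d ε ≤ 2 * rate n d ε := by
  have h1 := half_le_log (n := n) hd
  have h2 := two_le_add (n := n) hd
  -- The iterated logarithm is not needed for the running time, but it is negative for d = 2. As ε⁻²
  -- ≥ 1, this costs a factor of at most 2.
  have h3 : -(1 / 2) ≤ Real.log (Real.log d) := by
    rcases Nat.lt_or_ge d 2 with h | h
    · have : d = 1 := by omega
      subst this
      norm_num
    · have e1 : Real.log 2 ≤ Real.log d := Real.log_le_log two_pos (by exact_mod_cast h)
      have e2 : (2 / 3 : ℝ) ≤ Real.log d := by linarith [Real.log_two_gt_d9]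
      have e3 := Real.one_sub_inv_le_log_of_pos (show 0 < Real.log d by linarith)
      have e4 : (Real.log d)⁻¹ ≤ (2 / 3 : ℝ)⁻¹ := inv_anti₀ (by norm_num) e2
      norm_num at e4
      linarith
  have h4 : 1 ≤ (ε ^ 2)⁻¹ := (one_le_inv₀ (by positivity)).2 (pow_le_one₀ hε.le hε1)
  have h5 : (ε ^ 2)⁻¹ ≤ 2 * ((ε ^ 2)⁻¹ + Real.log (Real.log d)) := by linarith
  have h6 := mul_le_mul_of_nonneg_left h5
    (mul_nonneg (by linarith : (0 : ℝ) ≤ (n : ℝ) + d) (by linarith : 0 ≤ Real.log ((n : ℝ) + d)))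
  rw [mainRate, rate]
  linarith

theorem le_numIter (τ : ℝ) (n d : ℕ) (ε : ℝ) :
    300 * (mainRate n d ε / gainConst τ) ≤ numIter τ n d ε := Nat.le_ceil _

theorem one_le_mainRate_div (hτ : 1 ≤ τ) (hd : 1 ≤ d) (hε : 0 < ε) (hε1 : ε ≤ 1) :
    mainRate n d ε ≤ mainRate n d ε / gainConst τ := by
  have h1 := one_le_mainRate (n := n) hd hε hε1
  have h2 := gainConst_le hτ
  rw [le_div_iff₀ (gainConst_pos hτ)]
  exact mul_le_of_le_one_right (by linarith) (h2.trans (by norm_num))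

theorem numIter_le (hτ : 1 ≤ τ) (hd : 1 ≤ d) (hε : 0 < ε) (hε1 : ε ≤ 1) :
    (numIter τ n d ε : ℝ) ≤ 301 * (mainRate n d ε / gainConst τ) := by
  have h1 := one_le_mainRate_div (n := n) hτ hd hε hε1
  have h2 := one_le_mainRate (n := n) hd hε hε1
  have h3 : (numIter τ n d ε : ℝ) < 300 * (mainRate n d ε / gainConst τ) + 1 :=
    Nat.ceil_lt_add_one (by linarith)
  linarith

theorem algParams_gain_pos (hτ : 1 ≤ τ) (hd : 1 ≤ d) (hε : 0 < ε) :
    0 < (algParams τ n d ε).gain := by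
  have h1 := two_le_add (n := n) hd
  have h2 := gainConst_pos hτ
  exact div_pos (mul_pos h2 hε) (by linarith)

theorem algParams_gain_mul (hd : 1 ≤ d) :
    (algParams τ n d ε).gain * (n + d) = gainConst τ * ε := by
  have h1 := two_le_add (n := n) hd
  exact div_mul_cancel₀ _ (by linarith)

theorem algParams_gain_mul_mainRate (hτ : 1 ≤ τ) (hd : 1 ≤ d) (hε : 0 < ε) :
    (algParams τ n d ε).gain * (mainRate n d ε / gainConst τ) = Real.log (n + d) / ε := by
  have h1 := two_le_add (n := n) hd
  have h2 := gainConst_pos hτ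
  have h3 : (n : ℝ) + d ≠ 0 := by linarith
  simp only [algParams, mainRate]
  field_simp

theorem algParams_gain_le (hτ : 1 ≤ τ) (hd : 1 ≤ d) (hε : 0 < ε) (hε1 : ε ≤ 1) :
    τ * (algParams τ n d ε).gain * (n + d) ≤ (10 ^ 7)⁻¹ := by
  rw [mul_assoc, algParams_gain_mul hd]
  have h1 := mul_gainConst_le hτ
  have h2 := mul_nonneg (zero_le_one.trans hτ) (gainConst_pos hτ).le
  nlinarith

theorem scale_mul_le (hτ : 1 ≤ τ) (hd : 1 ≤ d) (hε : 0 < ε) (hε1 : ε ≤ 1) :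
    (algParams τ n d ε).scale * (3 * (algParams τ n d ε).τ) ≤ 1 := by
  have h1 := algParams_gain_le (n := n) hτ hd hε hε1
  have h2 := two_le_add (n := n) hd
  have h3 := mul_pos (zero_lt_one.trans_le hτ) (algParams_gain_pos (n := n) hτ hd hε)
  have h4 : (algParams τ n d ε).scale * (3 * (algParams τ n d ε).τ) =
      126 * (τ * (algParams τ n d ε).gain) := by
    simp only [algParams]
    ring
  rw [h4]
  have h5 := mul_le_mul_of_nonneg_left h2 h3.le
  norm_num at h1
  linarith

theorem mul_scale_le (hτ : 1 ≤ τ) (hd : 1 ≤ d) (hε : 0 < ε) (hε1 : ε ≤ 1) :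
    24 * (algParams τ n d ε).τ * n * (algParams τ n d ε).scale ≤ 1 := by
  have h1 := algParams_gain_le (n := n) hτ hd hε hε1
  have h3 := mul_pos (zero_lt_one.trans_le hτ) (algParams_gain_pos (n := n) hτ hd hε)
  have h4 : 24 * (algParams τ n d ε).τ * n * (algParams τ n d ε).scale =
      1008 * (τ * (algParams τ n d ε).gain * n) := by
    simp only [algParams]
    ring
  have h5 : 0 ≤ τ * (algParams τ n d ε).gain * d := by positivity
  rw [h4]
  norm_num at h1
  linarith

/-- The potential increases during all iterations by at most the factor `n + d` in expectation. -/
theorem growth_pow_le (hτ : 1 ≤ τ) (hd : 1 ≤ d) (hε : 0 < ε) (hε1 : ε ≤ 1) :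
    Real.exp (((algParams τ n d ε).scale * (3 * (algParams τ n d ε).τ)) ^ 2) ^ numIter τ n d ε ≤
      Real.exp (Real.log (n + d)) := by
  rw [← Real.exp_nat_mul]
  refine Real.exp_le_exp.2 ?_
  set g := (algParams τ n d ε).gain with hg
  have hg0 : 0 < g := algParams_gain_pos hτ hd hε
  have hL := half_le_log (n := n) hd
  set L := Real.log ((n : ℝ) + d) with hLdef
  have h1 : (algParams τ n d ε).scale * (3 * (algParams τ n d ε).τ) = 126 * τ * g := by
    simp only [hg, algParams]
    ring
  have h2 := mul_le_mul_of_nonneg_left (numIter_le (n := n) hτ hd hε hε1) hg0.le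
  have h3 := algParams_gain_mul_mainRate (n := n) hτ hd hε
  rw [← hg, ← hLdef] at h3
  have h4 : g * numIter τ n d ε ≤ 301 * (L / ε) := by linarith
  have h5 : g ≤ gainConst τ * ε := by
    rw [← algParams_gain_mul (n := n) (d := d) (τ := τ) (ε := ε) hd]
    exact le_mul_of_one_le_right hg0.le (by linarith [two_le_add (n := n) hd])
  have hLε : 0 ≤ 301 * (L / ε) := mul_nonneg (by norm_num) (div_nonneg (by linarith) hε.le)
  rw [h1]
  calc (numIter τ n d ε : ℝ) * (126 * τ * g) ^ 2
      = 15876 * τ ^ 2 * (g * (g * numIter τ n d ε)) := by ring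
    _ ≤ 15876 * τ ^ 2 * (gainConst τ * ε * (301 * (L / ε))) := by
        refine mul_le_mul_of_nonneg_left ?_ (by positivity)
        exact mul_le_mul h5 h4 (by positivity) (by have := gainConst_pos hτ; positivity)
    -- The number is 126²·301, which is below the 10⁷ in `gainConst`; the factor τ² cancels as well.
    _ = 4778676 * (τ ^ 2 * gainConst τ) * L := by
        field_simp
        ring
    _ ≤ L := by
        rw [sq_mul_gainConst hτ]
        norm_num
        linarith

end Constants

/-! ### Sure guarantees and the probability bound. -/

section Correctness

variable {τ ε : ℝ} {β : Fin d → ℝ} {Ψ : (Fin d → ℝ) → ℝ} {X : Fin n → Set (Fin d → ℝ)}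
  {f : Fin n → (Fin d → ℝ≥0) → (Fin d → ℝ)}

theorem orderedNorm_sum_oracle_le (hS : IsSetting (algParams τ n d ε) β Ψ X f) :
    optValue β X ≤ ∑ c, cost (f c 1) 1 := by
  refine (optValue_le hS.weight (sum_oracle_mem_feasible hS.oracle 1)).trans ?_
  refine (orderedNorm_le_sum hS.weight
    (feasible_subset_orthant hS.inst (sum_oracle_mem_feasible hS.oracle 1))).trans_eq ?_
  simp only [cost, Finset.sum_apply, Pi.one_apply, NNReal.coe_one, mul_one]
  exact Finset.sum_comm

theorem loopInv_initState (hS : IsSetting (algParams τ n d ε) β Ψ X f) :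
    LoopInv (algParams τ n d ε) β Ψ X ((∑ c, cost (f c 1) 1) / (τ * d)) 0
      (initState τ n d (∑ c, cost (f c 1) 1)) := by
  have hτ : 1 ≤ τ := hS.one_le_τ
  have hd := hS.weight.dim_pos
  have hd0 : (0 : ℝ) < d := by exact_mod_cast hd
  have hload : (initState τ n d (∑ c, cost (f c 1) 1)).loadVec = 0 := by
    funext i
    simp [State.loadVec, initState]
  refine ⟨0, 0, 0, rfl, le_rfl, by simp [initState], ?_, fun c => Or.inl ⟨rfl, rfl⟩, ?_, ?_, ?_⟩
  · have h1 := oracle_cost_le (β := β) (by linarith : 0 < τ) hS.inst hS.oracle 1 (b := d)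
      (fun z _ => by simpa using sum_le_card_mul_orderedNorm hS.weight z) hd0
    have h2 : (∑ c, cost (f c 1) 1) / (τ * d) ≤ optValue β X := by
      rw [div_le_iff₀ (by positivity)]
      refine h1.trans_eq ?_
      ring
    refine h2.trans (le_mul_of_one_le_left (optValue_nonneg hS.weight) ?_)
    linarith [hS.incr_pos]
  · intro i
    rw [hload]
    simp [initState]
  · rw [hload]
    have h1 := hS.approx.le_norm_add 0 (fun _ => le_rfl)
    have h2 : orderedNorm β 0 = 0 := by simp [orderedNorm, sortDown]
    rw [h2, zero_add] at h1
    simpa [initState] using h1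
  · rw [hload]
    simp [State.softMin, initState]

variable [NeZero n]

theorem isSetting_algParams (hτ : 1 ≤ τ) (hβ : IsOrderedWeight β)
    (hΨ : IsNormApprox β Ψ (Real.log d) 1) (hX : IsInstance X) (hf : IsApproxOracle τ X f)
    (hε : 0 < ε) : IsSetting (algParams τ n d ε) β Ψ X f :=
  ⟨hτ, hβ, hΨ, hX, hf, algParams_gain_pos hτ hβ.dim_pos hε, by simp only [algParams]; positivity⟩

/-- The initial guess is within a factor τd of the upper bound `a` and grows geometrically; take
logarithms and use log(1+ε/3) ≥ ε/4. -/
theorem iterations_bound (hτ : 1 ≤ τ) (hε : 0 < ε) (hε1 : ε ≤ 1) (hd : 1 ≤ d) {μ₀ μ a : ℝ} {R : ℕ}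
    (ha : 0 < a) (hμ₀ : μ₀ = a / (τ * d)) (hμ : μ = μ₀ * (1 + ε / 3) ^ R)
    (hle : μ ≤ (1 + ε / 3) * a) : ε * R ≤ 12 * τ * Real.log (n + d) := by
  have hL := half_le_log (n := n) hd
  have hd0 : (0 : ℝ) < d := by exact_mod_cast hd
  have hτ0 : 0 < τ := zero_lt_one.trans_le hτ
  have h1 : (1 + ε / 3) ^ R ≤ (1 + ε / 3) * (τ * d) := by
    rw [hμ, hμ₀, div_mul_eq_mul_div, div_le_iff₀ (by positivity)] at hle
    refine le_of_mul_le_mul_left (hle.trans_eq ?_) ha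
    ring
  have h2 := Real.log_le_log (by positivity) h1
  rw [Real.log_pow, Real.log_mul (by positivity) (by positivity),
    Real.log_mul hτ0.ne' hd0.ne'] at h2
  have h3 := Real.log_le_sub_one_of_pos hτ0
  have h4 : Real.log d ≤ Real.log ((n : ℝ) + d) :=
    Real.log_le_log hd0 (le_add_of_nonneg_left (Nat.cast_nonneg _))
  have h5 := Real.log_le_sub_one_of_pos (show 0 < 1 + ε / 3 by positivity)
  have h6 : ε / 4 ≤ Real.log (1 + ε / 3) := by
    have e1 := Real.one_sub_inv_le_log_of_pos (show 0 < 1 + ε / 3 by positivity)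
    have e2 : ε / 4 ≤ 1 - (1 + ε / 3)⁻¹ := by
      rw [le_sub_comm, inv_le_iff_one_le_mul₀ (by positivity)]
      nlinarith
    linarith
  have h7 := mul_le_mul_of_nonneg_left h6 (Nat.cast_nonneg (α := ℝ) R)
  have h8 : τ ≤ 2 * (τ * Real.log (n + d)) := by nlinarith
  have h9 : Real.log ((n : ℝ) + d) ≤ τ * Real.log (n + d) :=
    le_mul_of_one_le_left (by linarith) hτ
  linarith

theorem solution_spec (hS : IsSetting (algParams τ n d ε) β Ψ X f) (hε : 0 < ε) (hε1 : ε ≤ 1)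
    (ha : 0 < ∑ c, cost (f c 1) 1) {s : State n d}
    (h : LoopInv (algParams τ n d ε) β Ψ X ((∑ c, cost (f c 1) 1) / (τ * d)) (numIter τ n d ε) s)
    (hgood : s.IsGood (algParams τ n d ε)) :
    s.solution ∈ feasible X ∧ orderedNorm β s.solution ≤ (1 + ε) * τ * optValue β X := by
  have hτ : 1 ≤ τ := hS.one_le_τ
  have hd := hS.weight.dim_pos
  have hd0 : (0 : ℝ) < d := by exact_mod_cast hd
  have hg := hS.gain_pos
  have hμ : 0 < s.guess := h.guess_pos hS (by positivity)
  obtain ⟨R, N, J, hRN, h⟩ := h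
  have hbound : ε * R ≤ 12 * τ * Real.log (n + d) := by
    refine iterations_bound hτ hε hε1 hd ha rfl h.guess_eq
      (h.guess_le.trans (mul_le_mul_of_nonneg_left (orderedNorm_sum_oracle_le hS) ?_))
    linarith [hS.incr_pos]
  set g := (algParams τ n d ε).gain with hgdef
  have hgM : g * (n + d) = gainConst τ * ε := algParams_gain_mul hd
  have hκ := gainConst_pos hτ
  have hL := half_le_log (n := n) hd
  have hL0 : 0 ≤ Real.log ((n : ℝ) + d) := by linarith
  have hR1 : g * (n + d) * R ≤ 12 * (τ * gainConst τ) * Real.log (n + d) := by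
    rw [hgM]
    have := mul_le_mul_of_nonneg_left hbound hκ.le
    linarith
  refine h.solution_spec hS hμ hgood hε hε1 rfl ?_ ?_ ?_
  · rw [← hgdef, hgM]
    have h1 := mul_gainConst_le hτ
    have h2 := mul_le_mul_of_nonneg_right h1 hε.le
    have h3 : 48 * (algParams τ n d ε).τ * (gainConst τ * ε) = 48 * (τ * gainConst τ * ε) := by
      simp only [algParams]
      ring
    rw [h3]
    norm_num at h2
    linarith
  · have h1 : g * (12 * (algParams τ n d ε).τ * n * R) ≤ 12 * τ * (g * (n + d) * R) := by
      have h2 : 0 ≤ 12 * τ * (g * d * R) := by positivity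
      have h3 : (algParams τ n d ε).τ = τ := rfl
      rw [h3]
      linarith
    have h2 := mul_le_mul_of_nonneg_left hR1 (show 0 ≤ 12 * τ by positivity)
    have h3 : 12 * τ * (12 * (τ * gainConst τ) * Real.log ((n : ℝ) + d)) =
        144 * (τ ^ 2 * gainConst τ) * Real.log (n + d) := by ring
    rw [h3, sq_mul_gainConst hτ] at h2
    norm_num at h2
    linarith
  · have h1 := mul_le_mul_of_nonneg_left (le_numIter τ n d ε) hg.le
    rw [← hgdef]
    have h2 : g * (mainRate n d ε / gainConst τ) = Real.log (n + d) / ε :=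
      algParams_gain_mul_mainRate hτ hd hε
    have h3 : (numIter τ n d ε : ℝ) = R + N := by
      rw [← hRN]
      push_cast
      ring
    have h4 : g * R ≤ g * (n + d) * R := by
      have := two_le_add (n := n) hd
      exact mul_le_mul_of_nonneg_right (le_mul_of_one_le_right hg.le (by linarith))
        (Nat.cast_nonneg _)
    have h5 := mul_le_mul_of_nonneg_right (mul_gainConst_le hτ) hL0
    norm_num at h5
    have h6 : g * R ≤ Real.log (n + d) := by linarith
    have h7 : 300 * (Real.log ((n : ℝ) + d) / ε) ≤ g * (R + N) := by
      rw [← h3, ← h2]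
      linarith
    have h8 := mul_le_mul_of_nonneg_right h7 hε.le
    rw [mul_assoc, div_mul_cancel₀ _ hε.ne'] at h8
    have h9 := mul_le_mul h6 hε1 hε.le hL0
    linarith

/-- The potential starts at 2 and grows at most by the factor n + d, so it never reaches the value
(n+d)^42 that a bad state needs. -/
theorem isGood_iterate (hS : IsSetting (algParams τ n d ε) β Ψ X f) (hε : 0 < ε) (hε1 : ε ≤ 1)
    {a : ℝ} (ha : 0 < a) (g : (Fin d → ℝ) → (Fin d → ℝ)) :
    ((State.probeNext (algParams τ n d ε) f g)^[numIter τ n d ε] (initState τ n d a)).IsGood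
      (algParams τ n d ε) := by
  have hτ : 1 ≤ τ := hS.one_le_τ
  have hd := hS.weight.dim_pos
  have hd0 : (0 : ℝ) < d := by exact_mod_cast hd
  by_contra hbad
  have h1 := exp_log_lt_potential_of_not_isGood _ hbad
  have hscale : 0 < (algParams τ n d ε).scale := mul_pos (by norm_num) hS.gain_pos
  have h2 := State.potential_iterate_probeNext_le hS hscale (scale_mul_le hτ hd hε hε1) g
    (numIter τ n d ε) (initState τ n d a) (by simp only [initState]; positivity)
  rw [potential_initState] at h2
  have h3 := growth_pow_le (n := n) hτ hd hε hε1
  have h4 := half_le_log (n := n) hd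
  have h5 : (2 : ℝ) ≤ Real.exp (Real.log (n + d)) := by
    have := two_le_add (n := n) hd
    rwa [Real.exp_log (by linarith)]
  have h6 := Real.exp_lt_exp.2 (show Real.log ((n : ℝ) + d) + Real.log (n + d) <
    42 * Real.log (n + d) by linarith)
  rw [Real.exp_add] at h6
  nlinarith

theorem loopInv_iterate (hS : IsSetting (algParams τ n d ε) β Ψ X f) {μ₀ : ℝ} (hμ₀ : 0 < μ₀)
    (N k : ℕ) (s : State n d) (h : LoopInv (algParams τ n d ε) β Ψ X μ₀ k s) :
    LoopInv (algParams τ n d ε) β Ψ X μ₀ (k + N)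
      ((State.probeNext (algParams τ n d ε) f (orthantGrad Ψ))^[N] s) := by
  induction N generalizing k s with
  | zero => exact h
  | succ N ih =>
    rw [Function.iterate_succ_apply, add_comm N, ← add_assoc]
    exact ih _ _ (h.probeNext hS hμ₀)

/-- The algorithm always computes an approximately optimum solution. -/
theorem mainAlgorithm_spec (hS : IsSetting (algParams τ n d ε) β Ψ X f) (hε : 0 < ε) (hε1 : ε ≤ 1)
    {r : Outcome d} (hr : r ∈ ((mainAlgorithm τ ε).run f (orthantGrad Ψ)).support) :
    r.solution ∈ feasible X ∧ orderedNorm β r.solution ≤ (1 + ε) * τ * optValue β X ∧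
      r.gradEvals ≤ 2 * numIter τ n d ε ∧ r.oracleCalls ≤ n * (2 * numIter τ n d ε + 1) := by
  have hτ : 1 ≤ τ := hS.one_le_τ
  have hd := hS.weight.dim_pos
  have hd0 : (0 : ℝ) < d := by exact_mod_cast hd
  rw [mainAlgorithm, run_callAll, PMF.support_map] at hr
  obtain ⟨r₁, hr₁, rfl⟩ := hr
  split_ifs at hr₁ with ha
  · set a := ∑ c, cost (f c 1) 1 with hadef
    have hμ₀ : 0 < a / (τ * d) := by positivity
    obtain ⟨s, hs, r₂, hr₂, h1, h2, h3⟩ := exists_of_mem_support_randLoop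
      (algParams τ n d ε) f (orthantGrad Ψ) (finish τ ε a)
      (I := LoopInv (algParams τ n d ε) β Ψ X (a / (τ * d)))
      (fun k s c h => h.sampleNext hS hμ₀ c) (fun k s h => h.probeNext hS hμ₀) _ 0 _
      (loopInv_initState hS) hr₁
    rw [zero_add] at hs
    rw [finish] at hr₂
    simp only [Outcome.shift, h1, h2]
    split_ifs at hr₂ with hgood
    · rw [outputSolution, Algorithm.run, PMF.mem_support_pure_iff] at hr₂
      subst hr₂
      have h4 := solution_spec hS hε hε1 ha hs hgood
      dsimp only at h3 ⊢
      refine ⟨h4.1, h4.2, by omega, ?_⟩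
      have e1 : n * (2 * numIter τ n d ε + 1) = 2 * (numIter τ n d ε * n) + n := by ring
      rw [e1]
      omega
    · rw [run_detLoop, PMF.support_map] at hr₂
      obtain ⟨r₃, hr₃, rfl⟩ := hr₂
      rw [outputSolution, Algorithm.run, PMF.mem_support_pure_iff] at hr₃
      subst hr₃
      have h5 := loopInv_iterate hS hμ₀ (numIter τ n d ε) 0 _ (loopInv_initState hS)
      rw [zero_add] at h5
      have h4 := solution_spec hS hε hε1 ha h5 (isGood_iterate hS hε hε1 ha _)
      refine ⟨h4.1, h4.2, ?_, ?_⟩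
      · simp only [Outcome.shift]
        omega
      · have e1 : n * (2 * numIter τ n d ε + 1) = 2 * (numIter τ n d ε * n) + n := by ring
        rw [e1]
        simp only [Outcome.shift] at h3
        omega
  -- The answers have total load zero, so their sum has norm zero and is optimal.
  · rw [Algorithm.run, PMF.mem_support_pure_iff] at hr₁
    subst hr₁
    have h1 := sum_oracle_mem_feasible hS.oracle 1
    refine ⟨h1, ?_, by simp [Outcome.shift], ?_⟩
    · have h2 := orderedNorm_le_sum hS.weight (feasible_subset_orthant hS.inst h1)
      have h3 : ∑ i, (∑ c, f c 1) i = ∑ c, cost (f c 1) 1 := by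
        simp only [cost, Finset.sum_apply, Pi.one_apply, NNReal.coe_one, mul_one]
        exact Finset.sum_comm
      rw [h3] at h2
      have h4 := optValue_nonneg (X := X) hS.weight
      exact (h2.trans (not_lt.1 ha)).trans (by positivity)
    · simp only [Outcome.shift, zero_add]
      exact Nat.le_mul_of_pos_right _ (Nat.succ_pos _)

/-- The algorithm makes many oracle calls only with a small probability. -/
theorem mainAlgorithm_prob_le (hS : IsSetting (algParams τ n d ε) β Ψ X f) (hε : 0 < ε)
    (hε1 : ε ≤ 1) {T : ℝ}
    (hT : n + 3 * (numIter τ n d ε : ℝ) + 40 * (n * Real.log (n + d)) ≤ T) :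
    ((mainAlgorithm τ ε).run f (orthantGrad Ψ)).toOuterMeasure {r | T < r.oracleCalls} ≤
      ENNReal.ofReal ((((n : ℝ) * d) ^ 18)⁻¹) := by
  have hτ : 1 ≤ τ := hS.one_le_τ
  have hd := hS.weight.dim_pos
  have hn0 : (0 : ℝ) < n := Nat.cast_pos.mpr (NeZero.pos n)
  have hd0 : (0 : ℝ) < d := by exact_mod_cast hd
  have hL := half_le_log (n := n) hd
  set N := numIter τ n d ε with hN
  set L := Real.log ((n : ℝ) + d) with hLdef
  rw [mainAlgorithm, run_callAll, PMF.toOuterMeasure_map_apply]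
  split_ifs with ha
  · set a := ∑ c, cost (f c 1) 1 with hadef
    have hscale : 0 < (algParams τ n d ε).scale := mul_pos (by norm_num) hS.gain_pos
    set m : ℝ := 2 * N / (n + 1) + 40 * L with hm
    have hmain := prob_randLoop_le hS hscale (scale_mul_le hτ hd hε hε1) (mul_scale_le hτ hd hε hε1)
      (orthantGrad Ψ) (next := finish τ ε a) (good := fun s => s.IsGood (algParams τ n d ε))
      (fun s hs => ⟨_, if_pos hs⟩) (δ := Real.exp (-(42 * L))) (Real.exp_pos _).le
      (fun s hs => by
        have h1 := exp_log_lt_potential_of_not_isGood s hs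
        have h2 := mul_le_mul_of_nonneg_left h1 (Real.exp_pos (-(42 * L))).le
        rwa [← hLdef, ← Real.exp_add, neg_add_cancel, Real.exp_zero] at h2)
      (n + N) m N (initState τ n d a)
      (by simp only [initState]; positivity) n 0 (by simp)
    refine le_trans ?_ (hmain.trans (ENNReal.ofReal_le_ofReal ?_))
    · refine MeasureTheory.measure_mono fun r hr => ?_
      simp only [Outcome.shift, Set.mem_preimage, Set.mem_ofPred_eq] at hr ⊢
      refine lt_of_le_of_lt (le_trans ?_ hT) hr
      have h1 : (n : ℝ) * (2 * N / (n + 1)) ≤ 2 * N := by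
        rw [mul_div_assoc', div_le_iff₀ (by positivity)]
        have : (0 : ℝ) ≤ N := Nat.cast_nonneg _
        linarith
      rw [hm]
      push_cast
      linarith
    · rw [potential_initState]
      have hM := two_le_add (n := n) hd
      have hexpL : Real.exp L = (n : ℝ) + d := Real.exp_log (by linarith)
      have h1 : Real.exp (2 / ((n : ℝ) + 1)) ^ N * Real.exp ((0 : ℕ) - m) =
          Real.exp (-(40 * L)) := by
        rw [← Real.exp_nat_mul, ← Real.exp_add, hm]
        congr 1
        push_cast
        ring
      -- Of the exponent 42, one unit pays for the growth of the potential and one for its initial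
      -- value 2 ≤ n + d.
      have h2 : Real.exp (-(42 * L)) * (Real.exp (((algParams τ n d ε).scale *
          (3 * (algParams τ n d ε).τ)) ^ 2) ^ N * 2) ≤ Real.exp (-(40 * L)) := by
        have e1 := growth_pow_le (n := n) hτ hd hε hε1
        have e2 : Real.exp (((algParams τ n d ε).scale * (3 * (algParams τ n d ε).τ)) ^ 2) ^ N * 2 ≤
            Real.exp L * Real.exp L :=
          mul_le_mul e1 (hM.trans_eq hexpL.symm) (by norm_num) (Real.exp_pos _).le
        refine (mul_le_mul_of_nonneg_left e2 (Real.exp_pos _).le).trans_eq ?_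
        rw [← Real.exp_add, ← Real.exp_add]
        congr 1
        ring
      have h3 : Real.exp (-(40 * L)) = (((n : ℝ) + d) ^ 40)⁻¹ := by
        rw [Real.exp_neg, show (40 : ℝ) * L = (40 : ℕ) * L by norm_num, Real.exp_nat_mul, hexpL]
      rw [h1]
      -- Use nd ≤ (n+d)² and 2 ≤ (n+d)⁴, so 36 + 4 = 40.
      have h4 : 2 * (((n : ℝ) + d) ^ 40)⁻¹ ≤ ((((n : ℝ) * d)) ^ 18)⁻¹ := by
        have e1 : ((n : ℝ) * d) ^ 18 ≤ (((n : ℝ) + d) ^ 2) ^ 18 :=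
          pow_le_pow_left₀ (by positivity) (by nlinarith) _
        have e2 : 2 * ((n : ℝ) * d) ^ 18 ≤ ((n : ℝ) + d) ^ 40 := by
          have e3 : (2 : ℝ) ≤ ((n : ℝ) + d) ^ 4 :=
            hM.trans (le_self_pow₀ (by linarith) (by norm_num))
          calc 2 * ((n : ℝ) * d) ^ 18 ≤ ((n : ℝ) + d) ^ 4 * (((n : ℝ) + d) ^ 2) ^ 18 :=
                mul_le_mul e3 e1 (by positivity) (by positivity)
            _ = _ := by ring
        rw [← div_eq_mul_inv, div_le_iff₀ (by positivity), inv_mul_eq_div,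
          le_div_iff₀ (by positivity)]
        exact e2
      linarith
  · refine le_of_eq_of_le ?_ zero_le
    rw [Algorithm.run, PMF.toOuterMeasure_pure_apply, if_neg]
    simp only [Outcome.shift, Set.mem_preimage, Set.mem_ofPred_eq, not_lt, zero_add]
    refine le_trans ?_ hT
    have h1 : (0 : ℝ) ≤ N := Nat.cast_nonneg _
    have h2 : 0 ≤ (n : ℝ) * L := by positivity
    linarith

end Correctness

end Main

end OrderedNormMin

end

theorem mainTheorem10 (τ : ℝ) (hτ : 1 ≤ τ) :
    ∃ K : ℝ, 0 < K ∧
    ∃ alg : (d : ℕ) → (β : Fin d → ℝ) → (n : ℕ) → (ε : ℝ) → OrderedNormMin.Algorithm n d,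
      ∀ (d : ℕ) (β : Fin d → ℝ), OrderedNormMin.IsOrderedWeight β →
      ∀ Ψ : (Fin d → ℝ) → ℝ, OrderedNormMin.IsNormApprox β Ψ (Real.log d) 1 →
      ∀ n : ℕ, 1 ≤ n →
      ∀ X : Fin n → Set (Fin d → ℝ), OrderedNormMin.IsInstance X →
      ∀ f : Fin n → (Fin d → NNReal) → (Fin d → ℝ), OrderedNormMin.IsApproxOracle τ X f →
      ∀ ε : ℝ, 0 < ε → ε ≤ 1 →
        (∀ r ∈ ((alg d β n ε).run f (OrderedNormMin.orthantGrad Ψ)).support,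
          r.solution ∈ OrderedNormMin.feasible X ∧
          OrderedNormMin.orderedNorm β r.solution ≤
            (1 + ε) * τ * OrderedNormMin.optValue β X ∧
          (r.gradEvals : ℝ) ≤ K * OrderedNormMin.rate n d ε ∧
          (r.oracleCalls : ℝ) ≤ n * (K * OrderedNormMin.rate n d ε)) ∧
        ((alg d β n ε).run f (OrderedNormMin.orthantGrad Ψ)).toOuterMeasure
            {r | K * OrderedNormMin.rate n d ε < (r.oracleCalls : ℝ)} ≤
          ENNReal.ofReal ((((n : ℝ) * d) ^ 18)⁻¹) := by
  have hκ := OrderedNormMin.gainConst_pos hτ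
  -- In units of `mainRate / gainConst`, at most 3·301 + 2 + 40 ≤ 1000 calls are needed; another
  -- factor 2 comes from `mainRate_le_two_mul_rate`.
  refine ⟨2000 / OrderedNormMin.gainConst τ, by positivity, fun d _ n ε =>
    if h : n = 0 then .output 0 else
      haveI : NeZero n := ⟨h⟩
      OrderedNormMin.mainAlgorithm τ ε, ?_⟩
  intro d β hβ Ψ hΨ n hn X hX f hf ε hε hε1
  have hn0 : n ≠ 0 := by omega
  have : NeZero n := ⟨hn0⟩
  have hd := hβ.dim_pos
  have hS := OrderedNormMin.isSetting_algParams hτ hβ hΨ hX hf hε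
  have h1 := OrderedNormMin.numIter_le (n := n) hτ hd hε hε1
  have h2 := OrderedNormMin.one_le_mainRate_div (n := n) hτ hd hε hε1
  have h3 := OrderedNormMin.one_le_mainRate (n := n) hd hε hε1
  have h4 := OrderedNormMin.add_mul_log_le_mainRate (n := n) hd hε hε1
  have hL := OrderedNormMin.half_le_log (n := n) hd
  have hrate : 1000 * (OrderedNormMin.mainRate n d ε / OrderedNormMin.gainConst τ) ≤
      2000 / OrderedNormMin.gainConst τ * OrderedNormMin.rate n d ε := by
    have := mul_le_mul_of_nonneg_left
      (OrderedNormMin.mainRate_le_two_mul_rate (n := n) hd hε hε1)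
      (show 0 ≤ 1000 / OrderedNormMin.gainConst τ by positivity)
    refine le_trans (le_of_eq ?_) (this.trans_eq ?_) <;> ring
  simp only [dif_neg hn0]
  refine ⟨fun r hr => ?_, ?_⟩
  · obtain ⟨r1, r2, r3, r4⟩ := OrderedNormMin.mainAlgorithm_spec hS hε hε1 hr
    have r3' : (r.gradEvals : ℝ) ≤ 2 * OrderedNormMin.numIter τ n d ε := by exact_mod_cast r3
    have r4' : (r.oracleCalls : ℝ) ≤ n * (2 * OrderedNormMin.numIter τ n d ε + 1) := by
      exact_mod_cast r4
    refine ⟨r1, r2, by linarith, r4'.trans ?_⟩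
    exact mul_le_mul_of_nonneg_left (by linarith) (Nat.cast_nonneg _)
  · refine OrderedNormMin.mainAlgorithm_prob_le hS hε hε1 ?_
    have h5 : (n : ℝ) * Real.log (n + d) ≤ (n + d) * Real.log (n + d) :=
      mul_le_mul_of_nonneg_right (le_add_of_nonneg_right (Nat.cast_nonneg _)) (by linarith)
    have h6 : (n : ℝ) ≤ 2 * (n * Real.log (n + d)) := by
      have := mul_le_mul_of_nonneg_left hL (Nat.cast_nonneg (α := ℝ) n)
      linarith
    linarith
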